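/- Let $d\in\{1,2,3\}$ and $\tfrac12<b\le b'<\min\{\tfrac{6-d}{4},1\}$. For $\xi\in\mathbb R^d$ write $\|\xi\|=\sum_{i=1}^d|\xi_i|$, let $|\xi|$ be the Euclidean norm and $\langle\cdot\rangle=(1+|\cdot|^2)^{1/2}$, and let $e^{\pm\sigma\|D\|}$ be the Fourier multiplier in the space variable with symbol $e^{\pm\sigma\|\xi\|}$. Put $\widehat f(\tau,\xi)=\int_{\mathbb R^{1+d}}e^{-i(t\tau+x\cdot\xi)}f(t,x)\,dt\,dx$ (extended to tempered distributions) and $$\|f\|_{X^{s,b}}=\big\|\langle\xi\rangle^s\langle\tau+|\xi|^2\rangle^b\widehat f\big\|_{L^2_{\tau,\xi}},\qquad \|f\|_{X_\pm^{\sigma,s,b}}=\big\|e^{\sigma\|\xi\|}\langle\xi\rangle^s\langle\tau\pm|\xi|\rangle^b\widehat f\big\|_{L^2_{\tau,\xi}} .$$ There is a constant $C>0$ depending only on $d,b,b'$ such that for every $\sigma\ge0$, either choice of the sign $\pm$, every $v$ with $\|v\|_{X^{0,b}}<\infty$ and every $m$ with $\|m\|_{X_\pm^{\sigma,1,b}}<\infty$,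 the tempered distribution $$F(v,m)=vm-e^{\sigma\|D\|}\big(m\,e^{-\sigma\|D\|}v\big)$$ is well defined and $$\big\|\overline{F(v,m)}\big\|_{X^{0,b'-1}}\le C\,\sigma\,\|v\|_{X^{0,b}}\,\|m\|_{X_\pm^{\sigma,1,b}} .$$ -/

import Mathlib

open MeasureTheory SchwartzMap
open scoped ENNReal FourierTransform ComplexConjugate

noncomputable section

namespace GevreyBourgain

/-- Space-time `ℝ^{1+d}`, points `(t, x)`; also used for the dual variable `(τ, ξ)`. -/
abbrev Spacetime (d : ℕ) : Type := WithLp 2 (ℝ × EuclideanSpace ℝ (Fin d))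

/-- The bracket `⟨r⟩ = √(1 + r²)`. -/
def bracket (r : ℝ) : ℝ := Real.sqrt (1 + r ^ 2)

/-- `‖ξ‖ = ∑ᵢ |ξᵢ|`. -/
def l1norm {d : ℕ} (ξ : EuclideanSpace ℝ (Fin d)) : ℝ := ∑ i, |ξ i|

/-- The tempered distribution `f` is (integration against) the function `u`. -/
def IsFunction {d : ℕ} (f : 𝓢'(Spacetime d, ℂ)) (u : Spacetime d → ℂ) : Prop :=
  AEStronglyMeasurable u volume ∧
    ∀ φ : 𝓢(Spacetime d, ℂ),
      Integrable (fun z => φ z * u z) volume ∧ f φ = ∫ z, φ z * u z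

/-- The space-time Fourier transform of `f`, in the normalisation
`f̂(τ, ξ) = ∫ e^{-i(tτ + x·ξ)} f(t, x) dt dx`, is the function `g`. Mathlib's transform `𝓕` has the
kernel `e^{-2πi(tτ + x·ξ)}`, so that `𝓕 f (ζ) = f̂ (2πζ)`. -/
def HasFourier {d : ℕ} (f : 𝓢'(Spacetime d, ℂ)) (g : Spacetime d → ℂ) : Prop :=
  IsFunction (𝓕 f) (fun ζ => g ((2 * Real.pi) • ζ))

/-- `f' = a(D) f` for the spatial Fourier multiplier with symbol `a(ξ)`. -/
def IsMultiplier {d : ℕ} (a : EuclideanSpace ℝ (Fin d) → ℝ) (f f' : 𝓢'(Spacetime d, ℂ)) : Prop :=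
  ∃ g : Spacetime d → ℂ, HasFourier f g ∧ HasFourier f' (fun ζ => (a ζ.snd : ℂ) * g ζ)

/-- `f' = e^{σ‖D‖} f`, where `σ` may be negative. -/
def IsExpD {d : ℕ} (σ : ℝ) (f f' : 𝓢'(Spacetime d, ℂ)) : Prop :=
  IsMultiplier (fun ξ => Real.exp (σ * l1norm ξ)) f f'

/-- The norm `‖⟨ξ⟩^s ⟨τ - h(ξ)⟩^b f̂(τ, ξ)‖_{L²}`. The function `f̂` is unique up to null sets; the
value is `∞` if the Fourier transform of `f` is not a function. -/
def bourgainNorm {d : ℕ} (h : EuclideanSpace ℝ (Fin d) → ℝ) (s b : ℝ)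
    (f : 𝓢'(Spacetime d, ℂ)) : ℝ≥0∞ :=
  ⨅ (g : Spacetime d → ℂ) (_ : HasFourier f g),
    eLpNorm (fun ζ : Spacetime d =>
      ((bracket ‖ζ.snd‖ ^ s * bracket (ζ.fst - h ζ.snd) ^ b : ℝ) : ℂ) * g ζ) 2 volume

/-- The Gevrey-Bourgain norm `‖e^{σ‖D‖} f‖_{X_h^{s,b}}`; it is `∞` if `e^{σ‖D‖} f` is not a
tempered distribution. -/
def gevreyBourgainNorm {d : ℕ} (h : EuclideanSpace ℝ (Fin d) → ℝ) (σ s b : ℝ)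
    (f : 𝓢'(Spacetime d, ℂ)) : ℝ≥0∞ :=
  ⨅ (f' : 𝓢'(Spacetime d, ℂ)) (_ : IsExpD σ f f'), bourgainNorm h s b f'

/-- The phase `h(ξ) = -|ξ|²` of the spaces `X^{s,b}`. -/
def hSchr {d : ℕ} (ξ : EuclideanSpace ℝ (Fin d)) : ℝ := -‖ξ‖ ^ 2

/-- The two signs `±`. -/
inductive PM : Type
  | plus : PM
  | minus : PM

/-- The phase `h(ξ) = ∓|ξ|` of the spaces `X_±^{s,b}`. -/
def hWave {d : ℕ} : PM → EuclideanSpace ℝ (Fin d) → ℝ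
  | PM.plus, ξ => -‖ξ‖
  | PM.minus, ξ => ‖ξ‖

/-- `p` is the pointwise product of the distributions `f` and `g`, which are functions. -/
def IsProduct {d : ℕ} (f g p : 𝓢'(Spacetime d, ℂ)) : Prop :=
  ∃ u w : Spacetime d → ℂ, IsFunction f u ∧ IsFunction g w ∧ IsFunction p (fun z => u z * w z)

/-- `F = v m - e^{σ‖D‖} (m e^{-σ‖D‖} v)`, all the operations being defined. -/
def IsCommutator {d : ℕ} (σ : ℝ) (v m F : 𝓢'(Spacetime d, ℂ)) : Prop :=
  ∃ p w q r : 𝓢'(Spacetime d, ℂ),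
    IsProduct v m p ∧ IsExpD (-σ) v w ∧ IsProduct m w q ∧ IsExpD σ q r ∧ F = p - r

/-- Complex conjugation of Schwartz functions. -/
def conjSchwartz {d : ℕ} : 𝓢(Spacetime d, ℂ) →L[ℝ] 𝓢(Spacetime d, ℂ) :=
  SchwartzMap.postcompCLM (Complex.conjCLE : ℂ →L[ℝ] ℂ)

/-- The complex conjugate of a tempered distribution, `⟨f̄, φ⟩ = conj ⟨f, φ̄⟩`. -/
def conjDistribution {d : ℕ} (f : 𝓢'(Spacetime d, ℂ)) : 𝓢'(Spacetime d, ℂ) :=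
  ContinuousLinearMap.toPointwiseConvergenceCLM _ _ _ _
    { toFun := fun φ => conj (f (conjSchwartz φ))
      map_add' := fun φ ψ => by simp
      map_smul' := fun c φ => by
        have : conjSchwartz (c • φ) = conj c • conjSchwartz φ := by
          ext z
          simp [conjSchwartz]
        simp [this]
      cont := Complex.continuous_conj.comp (f.continuous.comp conjSchwartz.continuous) }

end GevreyBourgain

end

open GevreyBourgain

/-!
On the Fourier side `F` is the convolution of `v̂` and `m̂` against the factor
`1 - e^{σ(‖ξ‖ - ‖ξ - η‖)}`, where `η` is the frequency of `m`. This factor is at most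
`σ ‖η‖ e^{σ‖η‖}`: the power of `σ` is gained, `e^{σ‖η‖}⟨η⟩` is the weight of `m`, and a bilinear
convolution estimate with `σ = 0` remains. There the resonance identity
`(τ - |ξ|²) - (τ - τ' + |ξ - η|²) - (τ' - h(η)) = -|ξ|² - |ξ - η|² + h(η)` shows that one of the
three modulations dominates `|ξ|² + |ξ - η|²` up to a constant, since `h` grows at most linearly.
Cauchy–Schwarz with the dominant modulation kept outside reduces the estimate to the measure of an
`O(1)`-neighbourhood of a paraboloid-like level set in a ball of radius `N`, where `N²` is the size
of the dominant modulation. In polar coordinates this is `O(N^{max(d-2, 0)})`, which the factor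
`N^{-4(1-b')}` coming from the dominant weight absorbs.
-/

noncomputable section

namespace GevreyBourgain

theorem one_le_bracket (r : ℝ) : 1 ≤ bracket r :=
  Real.one_le_sqrt.2 (by nlinarith [sq_nonneg r])

theorem bracket_pos (r : ℝ) : 0 < bracket r := one_pos.trans_le (one_le_bracket r)

theorem abs_le_bracket (r : ℝ) : |r| ≤ bracket r :=
  Real.abs_le_sqrt (by linarith)

theorem bracket_neg (r : ℝ) : bracket (-r) = bracket r := by simp [bracket]

theorem continuous_bracket : Continuous bracket := by unfold bracket; fun_prop

theorem bracket_sub_le (r s : ℝ) : bracket (r - s) ≤ bracket r + bracket s := by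
  have hr := bracket_pos r
  have hs := bracket_pos s
  have hr2 : bracket r ^ 2 = 1 + r ^ 2 := Real.sq_sqrt (by positivity)
  have hs2 : bracket s ^ 2 = 1 + s ^ 2 := Real.sq_sqrt (by positivity)
  have hrs : -(r * s) ≤ bracket r * bracket s :=
    calc -(r * s) ≤ |r * s| := neg_le_abs _
      _ = |r| * |s| := abs_mul r s
      _ ≤ _ := mul_le_mul (abs_le_bracket r) (abs_le_bracket s) (abs_nonneg _) hr.le
  refine Real.sqrt_le_iff.2 ⟨by positivity, ?_⟩
  nlinarith

/-- The power `⟨r⟩ ^ p` as an extended nonnegative real, for use in lower integrals. -/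
def bracketPow (p r : ℝ) : ℝ≥0∞ := ENNReal.ofReal (bracket r ^ p)

@[fun_prop]
theorem measurable_bracketPow (p : ℝ) : Measurable (bracketPow p) :=
  (continuous_bracket.measurable.pow_const p).ennreal_ofReal

theorem bracketPow_neg_arg (p r : ℝ) : bracketPow p (-r) = bracketPow p r := by
  simp only [bracketPow, bracket_neg]

theorem bracketPow_add (p q r : ℝ) : bracketPow (p + q) r = bracketPow p r * bracketPow q r := by
  simp only [bracketPow, Real.rpow_add (bracket_pos r)]
  exact ENNReal.ofReal_mul (Real.rpow_nonneg (bracket_pos r).le p)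

theorem bracketPow_zero (r : ℝ) : bracketPow 0 r = 1 := by
  simp only [bracketPow, Real.rpow_zero, ENNReal.ofReal_one]

theorem bracketPow_mono {p q : ℝ} (h : p ≤ q) (r : ℝ) : bracketPow p r ≤ bracketPow q r :=
  ENNReal.ofReal_le_ofReal (Real.rpow_le_rpow_of_exponent_le (one_le_bracket r) h)

theorem bracketPow_neg_le_one {p : ℝ} (hp : 0 ≤ p) (r : ℝ) : bracketPow (-p) r ≤ 1 :=
  (bracketPow_mono (neg_nonpos.2 hp) r).trans_eq (bracketPow_zero r)

theorem bracketPow_neg_le_of_bracket_le_two_mul {p r s : ℝ} (hp : 0 ≤ p)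
    (h : bracket s ≤ 2 * bracket r) :
    bracketPow (-p) r ≤ ENNReal.ofReal (2 ^ p) * bracketPow (-p) s := by
  have hle : bracket r ^ (-p) ≤ (bracket s / 2) ^ (-p) :=
    Real.rpow_le_rpow_of_nonpos (half_pos (bracket_pos s)) (by linarith) (neg_nonpos.2 hp)
  rw [Real.div_rpow (bracket_pos s).le zero_le_two, Real.rpow_neg zero_le_two, div_inv_eq_mul,
    mul_comm] at hle
  simpa only [bracketPow, ENNReal.ofReal_mul (Real.rpow_nonneg zero_le_two p)]
    using ENNReal.ofReal_le_ofReal hle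

theorem lintegral_bracketPow_lt_top {p : ℝ} (hp : 1 < p) : ∫⁻ r, bracketPow (-p) r < ∞ := by
  have h := (integrable_rpow_neg_one_add_norm_sq (E := ℝ) (μ := volume) (r := p)
    (by simpa using hp)).lintegral_lt_top
  convert h using 4 with r
  simp only [bracketPow, bracket, Real.norm_eq_abs, sq_abs]
  rw [Real.sqrt_eq_rpow, ← Real.rpow_mul (by positivity)]
  congr 2
  ring

theorem bracketPow_sub_mul_bracketPow_sub_le {p : ℝ} (hp : 0 ≤ p) (τ α β : ℝ) :
    bracketPow (-p) (τ - α) * bracketPow (-p) (τ - β) ≤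
      ENNReal.ofReal (2 ^ p) * bracketPow (-p) (α - β) *
        (bracketPow (-p) (τ - α) + bracketPow (-p) (τ - β)) := by
  have htri : bracket (α - β) ≤ bracket (τ - α) + bracket (τ - β) := by
    have h := bracket_sub_le (τ - β) (τ - α)
    rwa [sub_sub_sub_cancel_left, add_comm] at h
  rcases le_total (bracket (τ - α)) (bracket (τ - β)) with h | h
  · calc _ ≤ bracketPow (-p) (τ - α) * (ENNReal.ofReal (2 ^ p) * bracketPow (-p) (α - β)) := by
          gcongr; exact bracketPow_neg_le_of_bracket_le_two_mul hp (by linarith)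
      _ = ENNReal.ofReal (2 ^ p) * bracketPow (-p) (α - β) * bracketPow (-p) (τ - α) := by ring
      _ ≤ _ := by gcongr; exact le_self_add
  · calc _ ≤ (ENNReal.ofReal (2 ^ p) * bracketPow (-p) (α - β)) * bracketPow (-p) (τ - β) := by
          gcongr; exact bracketPow_neg_le_of_bracket_le_two_mul hp (by linarith)
      _ ≤ _ := by gcongr; exact le_add_self

theorem lintegral_bracketPow_sub_mul_bracketPow_sub_le {p : ℝ} (hp : 0 ≤ p) (α β : ℝ) :
    ∫⁻ τ, bracketPow (-p) (τ - α) * bracketPow (-p) (τ - β) ≤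
      ENNReal.ofReal (2 ^ p) * (2 * ∫⁻ r, bracketPow (-p) r) * bracketPow (-p) (α - β) :=
  calc _ ≤ ∫⁻ τ, ENNReal.ofReal (2 ^ p) * bracketPow (-p) (α - β) *
        (bracketPow (-p) (τ - α) + bracketPow (-p) (τ - β)) :=
      lintegral_mono fun τ => bracketPow_sub_mul_bracketPow_sub_le hp τ α β
    _ = ENNReal.ofReal (2 ^ p) * bracketPow (-p) (α - β) *
        ((∫⁻ τ, bracketPow (-p) (τ - α)) + ∫⁻ τ, bracketPow (-p) (τ - β)) := by
      rw [lintegral_const_mul _ (by fun_prop), lintegral_add_left (by fun_prop)]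
    _ = _ := by
      rw [lintegral_sub_right_eq_self (bracketPow (-p)),
        lintegral_sub_right_eq_self (bracketPow (-p))]
      ring

section Expansive

variable {S : Set ℝ} {ψ : ℝ → ℝ}

theorem volume_inter_preimage_le_of_expansive (hψ : ∀ x ∈ S, ∀ y ∈ S, dist x y ≤ dist (ψ x) (ψ y))
    (T : Set ℝ) : volume (S ∩ ψ ⁻¹' T) ≤ volume T := by
  have hanti : AntilipschitzWith 1 (S.domRestrict ψ) :=
    AntilipschitzWith.of_le_mul_dist fun x y => by
      simpa [Subtype.dist_eq] using hψ x x.2 y y.2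
  have h := hanti.hausdorffMeasure_preimage_le zero_le_one T
  rw [← isometry_subtype_coe.hausdorffMeasure_image (Or.inl zero_le_one), Set.domRestrict_eq,
    Set.preimage_comp, Subtype.image_preimage_coe, hausdorffMeasure_real] at h
  simpa using h

theorem setLIntegral_comp_le_of_expansive (hψm : Measurable ψ)
    (hψ : ∀ x ∈ S, ∀ y ∈ S, dist x y ≤ dist (ψ x) (ψ y)) {f : ℝ → ℝ≥0∞} (hf : Measurable f) :
    ∫⁻ x in S, f (ψ x) ≤ ∫⁻ x, f x := by
  rw [← lintegral_map hf hψm]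
  refine lintegral_mono' (Measure.le_iff.2 fun T hT => ?_) le_rfl
  rw [Measure.map_apply hψm hT, Measure.restrict_apply (hψm hT), Set.inter_comm]
  exact volume_inter_preimage_le_of_expansive hψ T

end Expansive

theorem dist_sq_div_two_le_dist {φ : ℝ → ℝ}
    (hφ : MonotoneOn (fun r => φ r - r ^ 2 / 2) (Set.Ici 1)) {r s : ℝ} (hr : r ∈ Set.Ici 1)
    (hs : s ∈ Set.Ici 1) : dist (r ^ 2 / 2) (s ^ 2 / 2) ≤ dist (φ r) (φ s) := by
  wlog hsr : s ≤ r generalizing r s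
  · rw [dist_comm, dist_comm (φ r)]
    exact this hs hr (le_of_not_ge hsr)
  have hmono : φ s - s ^ 2 / 2 ≤ φ r - r ^ 2 / 2 := hφ hs hr hsr
  have hsq : s ^ 2 ≤ r ^ 2 := pow_le_pow_left₀ (zero_le_one.trans hs) hsr 2
  rw [Real.dist_eq, Real.dist_eq, abs_of_nonneg (by linarith)]
  exact (by linarith : _ ≤ φ r - φ s).trans (le_abs_self _)

theorem setLIntegral_Ioi_mul_comp_le {φ : ℝ → ℝ} (hφm : Measurable φ)
    (hφ : MonotoneOn (fun r => φ r - r ^ 2 / 2) (Set.Ici 1)) {f : ℝ → ℝ≥0∞} (hf : Measurable f) :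
    ∫⁻ r in Set.Ioi 1, ENNReal.ofReal r * f (φ r) ≤ ∫⁻ x, f x := by
  have hsqrt : ∀ r ∈ Set.Ioi (1 : ℝ), √(2 * (r ^ 2 / 2)) = r := fun r hr => by
    rw [mul_div_cancel₀ _ two_ne_zero, Real.sqrt_sq (zero_le_one.trans hr.le)]
  have hderiv : ∀ r ∈ Set.Ioi (1 : ℝ),
      HasDerivWithinAt (fun r : ℝ => r ^ 2 / 2) r (Set.Ioi 1) r := fun r _ => by
    simpa using ((hasDerivAt_pow 2 r).div_const 2).hasDerivWithinAt
  have hinj : Set.InjOn (fun r : ℝ => r ^ 2 / 2) (Set.Ioi 1) :=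
    Set.LeftInvOn.injOn (f₁' := fun u => √(2 * u)) hsqrt
  have hexp : ∀ x ∈ (fun r : ℝ => r ^ 2 / 2) '' Set.Ioi 1,
      ∀ y ∈ (fun r : ℝ => r ^ 2 / 2) '' Set.Ioi 1,
        dist x y ≤ dist (φ √(2 * x)) (φ √(2 * y)) := by
    rintro _ ⟨r, hr, rfl⟩ _ ⟨s, hs, rfl⟩
    simpa only [hsqrt r hr, hsqrt s hs] using
      dist_sq_div_two_le_dist hφ (Set.Ioi_subset_Ici_self hr) (Set.Ioi_subset_Ici_self hs)
  calc ∫⁻ r in Set.Ioi 1, ENNReal.ofReal r * f (φ r)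
      = ∫⁻ r in Set.Ioi 1, ENNReal.ofReal |r| * f (φ √(2 * (r ^ 2 / 2))) := by
        refine setLIntegral_congr_fun measurableSet_Ioi fun r (hr : 1 < r) => ?_
        simp only [hsqrt r hr, abs_of_pos (zero_lt_one.trans hr)]
    _ = ∫⁻ u in (fun r : ℝ => r ^ 2 / 2) '' Set.Ioi 1, f (φ √(2 * u)) :=
        (lintegral_image_eq_lintegral_abs_deriv_mul measurableSet_Ioi hderiv hinj
          fun u => f (φ √(2 * u))).symm
    _ ≤ ∫⁻ x, f x := setLIntegral_comp_le_of_expansive (by fun_prop) hexp hf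

theorem setLIntegral_Ioc_pow_mul_bracketPow_le {p : ℝ} (hp : 0 ≤ p) {φ : ℝ → ℝ}
    (hφm : Measurable φ) (hφ : MonotoneOn (fun r => φ r - r ^ 2 / 2) (Set.Ici 1)) (n : ℕ) {N : ℝ}
    (hN : 1 ≤ N) :
    ∫⁻ r in Set.Ioc 0 N, ENNReal.ofReal (r ^ (n - 1)) * bracketPow (-p) (φ r) ≤
      (1 + ∫⁻ r, bracketPow (-p) r) * ENNReal.ofReal (N ^ (n - 2)) := by
  have hnear : ∫⁻ r in Set.Ioc (0 : ℝ) 1, ENNReal.ofReal (r ^ (n - 1)) * bracketPow (-p) (φ r) ≤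
      ENNReal.ofReal (N ^ (n - 2)) :=
    calc _ ≤ ∫⁻ _ in Set.Ioc (0 : ℝ) 1, 1 :=
          setLIntegral_mono' measurableSet_Ioc fun r hr => mul_le_one'
            (ENNReal.ofReal_le_one.2 (pow_le_one₀ hr.1.le hr.2)) (bracketPow_neg_le_one hp _)
      _ ≤ _ := by simpa using one_le_pow₀ hN
  have hpow : ∀ r ∈ Set.Ioc 1 N, r ^ (n - 1) ≤ N ^ (n - 2) * r := by
    rintro r ⟨h1r, hrN⟩
    rcases Nat.lt_or_ge n 2 with hn | hn
    · simpa [show n - 1 = 0 by omega, show n - 2 = 0 by omega] using h1r.le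
    · rw [show n - 1 = n - 2 + 1 by omega, pow_succ]
      gcongr
  have hfar : ∫⁻ r in Set.Ioc 1 N, ENNReal.ofReal (r ^ (n - 1)) * bracketPow (-p) (φ r) ≤
      ENNReal.ofReal (N ^ (n - 2)) * ∫⁻ r, bracketPow (-p) r :=
    calc _ ≤ ∫⁻ r in Set.Ioc 1 N,
          ENNReal.ofReal (N ^ (n - 2)) * (ENNReal.ofReal r * bracketPow (-p) (φ r)) := by
          refine setLIntegral_mono' measurableSet_Ioc fun r hr => ?_
          rw [← mul_assoc, ← ENNReal.ofReal_mul (by positivity)]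
          gcongr
          exact hpow r hr
      _ = ENNReal.ofReal (N ^ (n - 2)) *
          ∫⁻ r in Set.Ioc 1 N, ENNReal.ofReal r * bracketPow (-p) (φ r) :=
          lintegral_const_mul _ (by fun_prop)
      _ ≤ _ := by
          refine mul_le_mul' le_rfl ((lintegral_mono_set Set.Ioc_subset_Ioi_self).trans ?_)
          exact setLIntegral_Ioi_mul_comp_le hφm hφ (measurable_bracketPow _)
  rw [← Set.Ioc_union_Ioc_eq_Ioc zero_le_one hN, mul_comm, mul_add, mul_one]
  exact (lintegral_union_le _ _ _).trans (add_le_add hnear hfar)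

section Polar

variable {E : Type*} [NormedAddCommGroup E] [NormedSpace ℝ E]

/-- Outside the unit ball, `f` grows along rays at least as fast as `‖x‖² / 2`. This is all that
the measure estimates near the zero set of a resonance function `f` require. -/
def QuadraticGrowth (f : E → ℝ) : Prop :=
  ∀ ω : E, ‖ω‖ = 1 → MonotoneOn (fun r : ℝ => f (r • ω) - r ^ 2 / 2) (Set.Ici 1)

variable [FiniteDimensional ℝ E] [Nontrivial E] [MeasurableSpace E] [BorelSpace E] (μ : Measure E)
  [μ.IsAddHaarMeasure]

theorem lintegral_eq_lintegral_toSphere {f : E → ℝ≥0∞} (hf : Measurable f) :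
    ∫⁻ x, f x ∂μ = ∫⁻ ω : Metric.sphere (0 : E) 1, ∫⁻ r in Set.Ioi (0 : ℝ),
      ENNReal.ofReal (r ^ (Module.finrank ℝ E - 1)) * f (r • (ω : E)) ∂volume ∂μ.toSphere := by
  have hprod : ∫⁻ x, f x ∂μ =
      ∫⁻ y : Metric.sphere (0 : E) 1 × Set.Ioi (0 : ℝ), f ((y.2 : ℝ) • (y.1 : E))
        ∂(μ.toSphere.prod (.volumeIoiPow (Module.finrank ℝ E - 1))) := by
    rw [← μ.measurePreserving_homeomorphUnitSphereProd.lintegral_comp (by fun_prop)]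
    conv_lhs => rw [← restrict_compl_singleton (μ := μ) (0 : E),
      ← lintegral_subtype_comap (measurableSet_singleton _).compl]
    refine lintegral_congr fun x => ?_
    have hx : ‖(x : E)‖ ≠ 0 := norm_ne_zero_iff.2 x.2
    simp [smul_smul, hx]
  rw [hprod, lintegral_prod _ (by fun_prop)]
  refine lintegral_congr fun ω => ?_
  rw [Measure.volumeIoiPow, lintegral_withDensity_eq_lintegral_mul _ (by fun_prop) (by fun_prop)]
  exact lintegral_subtype_comap measurableSet_Ioi
    (fun r : ℝ => ENNReal.ofReal (r ^ (Module.finrank ℝ E - 1)) * f (r • (ω : E)))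

theorem setLIntegral_closedBall_eq_lintegral_toSphere {f : E → ℝ≥0∞} (hf : Measurable f) (N : ℝ) :
    ∫⁻ x in Metric.closedBall 0 N, f x ∂μ =
      ∫⁻ ω : Metric.sphere (0 : E) 1, ∫⁻ r in Set.Ioc 0 N,
        ENNReal.ofReal (r ^ (Module.finrank ℝ E - 1)) * f (r • (ω : E)) ∂volume ∂μ.toSphere := by
  rw [← lintegral_indicator measurableSet_closedBall,
    lintegral_eq_lintegral_toSphere μ (hf.indicator measurableSet_closedBall)]
  refine lintegral_congr fun ω => ?_
  rw [← Set.Ioi_inter_Iic, Set.inter_comm, ← setLIntegral_indicator measurableSet_Iic]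
  refine setLIntegral_congr_fun measurableSet_Ioi fun r (hr : 0 < r) => ?_
  by_cases hrN : r ≤ N <;> simp [Set.indicator, norm_smul, abs_of_pos hr, hrN]

theorem setLIntegral_closedBall_bracketPow_le {p : ℝ} (hp : 0 ≤ p) {f : E → ℝ}
    (hfm : Measurable f) (hf : QuadraticGrowth f) {N : ℝ} (hN : 1 ≤ N) :
    ∫⁻ x in Metric.closedBall 0 N, bracketPow (-p) (f x) ∂μ ≤
      (1 + ∫⁻ r, bracketPow (-p) r) * ENNReal.ofReal (N ^ (Module.finrank ℝ E - 2)) *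
        μ.toSphere Set.univ := by
  rw [setLIntegral_closedBall_eq_lintegral_toSphere μ (by fun_prop), ← lintegral_const]
  exact lintegral_mono fun ω => setLIntegral_Ioc_pow_mul_bracketPow_le hp (by fun_prop)
    (hf (ω : E) (norm_eq_of_mem_sphere ω)) _ hN

end Polar

theorem lintegral_spacetime {d : ℕ} {f : Spacetime d → ℝ≥0∞} (hf : Measurable f) :
    ∫⁻ ζ, f ζ = ∫⁻ ξ, ∫⁻ τ, f (WithLp.toLp 2 (τ, ξ)) := by
  have hf' : Measurable fun z : ℝ × EuclideanSpace ℝ (Fin d) => f (WithLp.toLp 2 z) :=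
    hf.comp (WithLp.prod_continuous_toLp 2 ℝ _).measurable
  rw [← lintegral_prod_symm (fun z => f (WithLp.toLp 2 z)) hf'.aemeasurable]
  exact (WithLp.volume_preserving_ofLp ℝ (EuclideanSpace ℝ (Fin d))).lintegral_comp hf'

/-- The modulation `τ - h(ξ)` of the point `ζ = (τ, ξ)` with respect to the phase `h`. -/
def modulation {d : ℕ} (h : EuclideanSpace ℝ (Fin d) → ℝ) (ζ : Spacetime d) : ℝ :=
  ζ.fst - h ζ.snd

@[fun_prop]
theorem measurable_modulation {d : ℕ} {h : EuclideanSpace ℝ (Fin d) → ℝ} (hh : Measurable h) :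
    Measurable (modulation h) := by
  unfold modulation; fun_prop

/-- The constant in the `L²` bounds for `resonantWeight`; its last factor is the area of the unit
sphere. -/
def resonanceConst (d : ℕ) (p : ℝ) : ℝ≥0∞ :=
  ENNReal.ofReal (2 ^ p) * (2 * ∫⁻ r, bracketPow (-p) r) *
    ((1 + ∫⁻ r, bracketPow (-p) r) * ENNReal.ofReal (3 ^ (d - 2)) *
      (volume : Measure (EuclideanSpace ℝ (Fin d))).toSphere Set.univ)

theorem resonanceConst_lt_top (d : ℕ) {p : ℝ} (hp : 1 < p) : resonanceConst d p < ∞ := by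
  have hI := lintegral_bracketPow_lt_top hp
  unfold resonanceConst
  finiteness

section Resonance

variable {d : ℕ} {α β : EuclideanSpace ℝ (Fin d) → ℝ}

theorem setLIntegral_bracketPow_modulation_le {p : ℝ} (hp : 0 ≤ p)
    {S : Set (EuclideanSpace ℝ (Fin d))} (hS : MeasurableSet S) (hα : Measurable α)
    (hβ : Measurable β) :
    ∫⁻ ζ in {ζ : Spacetime d | ζ.snd ∈ S},
        bracketPow (-p) (modulation α ζ) * bracketPow (-p) (modulation β ζ) ≤
      ENNReal.ofReal (2 ^ p) * (2 * ∫⁻ r, bracketPow (-p) r) *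
        ∫⁻ ξ in S, bracketPow (-p) (α ξ - β ξ) := by
  have hS' : MeasurableSet {ζ : Spacetime d | ζ.snd ∈ S} :=
    hS.preimage (WithLp.continuous_snd ..).measurable
  have hm : Measurable fun ζ : Spacetime d =>
      bracketPow (-p) (modulation α ζ) * bracketPow (-p) (modulation β ζ) := by fun_prop
  rw [← lintegral_indicator hS', lintegral_spacetime (hm.indicator hS'),
    ← lintegral_const_mul _ (by fun_prop), ← lintegral_indicator hS]
  refine lintegral_mono fun ξ => ?_
  by_cases hξ : ξ ∈ S
  · simpa [Set.indicator, hξ, modulation] using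
      lintegral_bracketPow_sub_mul_bracketPow_sub_le hp (α ξ) (β ξ)
  · simp [Set.indicator, hξ]

theorem setLIntegral_closedBall_bracketPow_modulation_le (hd : d ≠ 0) {p : ℝ} (hp : 0 ≤ p)
    (hα : Measurable α) (hβ : Measurable β) {c : EuclideanSpace ℝ (Fin d)}
    (hαβ : QuadraticGrowth fun ξ => α (ξ + c) - β (ξ + c)) {N : ℝ} (hN : 1 ≤ N) :
    ∫⁻ ζ in {ζ : Spacetime d | ζ.snd ∈ Metric.closedBall c (3 * N)},
        bracketPow (-p) (modulation α ζ) * bracketPow (-p) (modulation β ζ) ≤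
      resonanceConst d p * ENNReal.ofReal (N ^ (d - 2)) := by
  have : Nonempty (Fin d) := Fin.pos_iff_nonempty.1 (Nat.pos_of_ne_zero hd)
  have hball : ∫⁻ ξ in Metric.closedBall c (3 * N), bracketPow (-p) (α ξ - β ξ) =
      ∫⁻ ξ in Metric.closedBall 0 (3 * N), bracketPow (-p) (α (ξ + c) - β (ξ + c)) := by
    have h := (measurePreserving_add_right volume c).setLIntegral_comp_preimage
      (measurableSet_closedBall (x := c) (ε := 3 * N))
      (f := fun ξ => bracketPow (-p) (α ξ - β ξ)) (by fun_prop)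
    rw [← h]
    congr! 2
    ext ξ
    simp
  refine (setLIntegral_bracketPow_modulation_le hp measurableSet_closedBall hα hβ).trans ?_
  rw [resonanceConst, mul_assoc _ _ (ENNReal.ofReal (N ^ (d - 2))), hball]
  refine mul_le_mul' le_rfl
    ((setLIntegral_closedBall_bracketPow_le _ hp (by fun_prop) hαβ (by linarith)).trans_eq ?_)
  rw [finrank_euclideanSpace_fin, mul_pow, ENNReal.ofReal_mul (by positivity)]
  ring

/-- The weight `⟨x⟩^{-a} ⟨y⟩^{-b} ⟨z⟩^{-b}`, restricted to the region where `⟨x⟩` controls the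
quantity `R`. In the application `x`, `y`, `z` are the three modulations of an interaction, `x` is
the dominant one, and `R` is the size forced on it by the resonance identity. -/
def resonantWeight (a b R x y z : ℝ) : ℝ≥0∞ :=
  if R ≤ 8 * bracket x then bracketPow (-a) x * (bracketPow (-b) y * bracketPow (-b) z) else 0

@[fun_prop]
theorem measurable_resonantWeight {γ : Type*} [MeasurableSpace γ] (a b : ℝ) {R x y z : γ → ℝ}
    (hR : Measurable R) (hx : Measurable x) (hy : Measurable y) (hz : Measurable z) :
    Measurable fun t => resonantWeight a b (R t) (x t) (y t) (z t) := by
  have hxm := continuous_bracket.measurable.comp hx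
  exact Measurable.ite (measurableSet_le hR (hxm.const_mul 8)) (by fun_prop) measurable_const

theorem resonantWeight_swap (a b R x y z : ℝ) :
    resonantWeight a b R x y z = resonantWeight a b R x z y := by
  simp only [resonantWeight, mul_comm (bracketPow (-b) y)]

theorem resonantWeight_neg_right (a b R x y z : ℝ) :
    resonantWeight a b R x y (-z) = resonantWeight a b R x y z := by
  simp only [resonantWeight, bracketPow_neg_arg]

theorem bracketPow_sq (p r : ℝ) : bracketPow p r ^ 2 = bracketPow (2 * p) r := by
  rw [sq, ← bracketPow_add, two_mul]

theorem bracketPow_neg_mul_self (p r : ℝ) : bracketPow (-p) r * bracketPow p r = 1 := by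
  rw [← bracketPow_add, neg_add_cancel, bracketPow_zero]

theorem ofReal_sqrt_bracket_pow_le {n : ℕ} {a : ℝ} (ha : n ≤ 4 * a) (x : ℝ) :
    ENNReal.ofReal (√(bracket x) ^ n) ≤ bracketPow (2 * a) x := by
  refine ENNReal.ofReal_le_ofReal ?_
  rw [Real.sqrt_eq_rpow, ← Real.rpow_natCast, ← Real.rpow_mul (bracket_pos x).le]
  exact Real.rpow_le_rpow_of_exponent_le (one_le_bracket x) (by linarith)

theorem lintegral_sq_resonantWeight_le (hd : d ≠ 0) {a b : ℝ} (hb : 0 ≤ b)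
    (ha : ((d - 2 : ℕ) : ℝ) ≤ 4 * a) (hα : Measurable α) (hβ : Measurable β)
    {c : EuclideanSpace ℝ (Fin d)} (hαβ : QuadraticGrowth fun ξ => α (ξ + c) - β (ξ + c))
    {R : EuclideanSpace ℝ (Fin d) → ℝ} (hR : ∀ ξ, ‖ξ - c‖ ^ 2 ≤ R ξ) (x : ℝ) :
    ∫⁻ ζ : Spacetime d, resonantWeight a b (R ζ.snd) x (modulation α ζ) (modulation β ζ) ^ 2 ≤
      resonanceConst d (2 * b) := by
  set S : Set (Spacetime d) := {ζ | ζ.snd ∈ Metric.closedBall c (3 * √(bracket x))}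
  have hS : MeasurableSet S :=
    measurableSet_closedBall.preimage (WithLp.continuous_snd ..).measurable
  have hRS : ∀ ζ : Spacetime d, R ζ.snd ≤ 8 * bracket x → ζ ∈ S := fun ζ hζ => by
    rw [Set.mem_ofPred_eq, mem_closedBall_iff_norm]
    refine abs_le_of_sq_le_sq' ?_ (by positivity) |>.2
    rw [mul_pow, Real.sq_sqrt (bracket_pos x).le]
    linarith [hR ζ.snd, bracket_pos x]
  have hpt : ∀ ζ : Spacetime d,
      resonantWeight a b (R ζ.snd) x (modulation α ζ) (modulation β ζ) ^ 2 ≤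
        bracketPow (-(2 * a)) x * S.indicator (fun ζ =>
          bracketPow (-(2 * b)) (modulation α ζ) * bracketPow (-(2 * b)) (modulation β ζ)) ζ := by
    intro ζ
    by_cases hζ : R ζ.snd ≤ 8 * bracket x
    · simp only [resonantWeight, if_pos hζ, Set.indicator_of_mem (hRS ζ hζ), mul_pow,
        bracketPow_sq, mul_neg, le_refl]
    · simp [resonantWeight, hζ]
  calc _ ≤ bracketPow (-(2 * a)) x * ∫⁻ ζ in S,
        bracketPow (-(2 * b)) (modulation α ζ) * bracketPow (-(2 * b)) (modulation β ζ) := by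
        rw [← lintegral_indicator hS, ← lintegral_const_mul _ (Measurable.indicator
          (by fun_prop) hS)]
        exact lintegral_mono hpt
    _ ≤ bracketPow (-(2 * a)) x * (resonanceConst d (2 * b) * bracketPow (2 * a) x) := by
        gcongr
        refine (setLIntegral_closedBall_bracketPow_modulation_le hd (by positivity) hα hβ hαβ
          (Real.one_le_sqrt.2 (one_le_bracket x))).trans ?_
        gcongr
        exact ofReal_sqrt_bracket_pow_le ha x
    _ = resonanceConst d (2 * b) := by
        rw [mul_left_comm, bracketPow_neg_mul_self, mul_one]

end Resonance

theorem bracketPow_mul_swap_le {a b x y : ℝ} (hab : a ≤ b) (h : bracket x ≤ bracket y) :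
    bracketPow (-a) x * bracketPow (-b) y ≤ bracketPow (-a) y * bracketPow (-b) x :=
  have hba : bracketPow (b - a) x ≤ bracketPow (b - a) y :=
    ENNReal.ofReal_le_ofReal
      (Real.rpow_le_rpow (bracket_pos x).le h (sub_nonneg.2 hab))
  calc bracketPow (-a) x * bracketPow (-b) y
      = bracketPow (b - a) x * (bracketPow (-b) x * bracketPow (-b) y) := by
        rw [← mul_assoc, ← bracketPow_add]
        ring_nf
    _ ≤ bracketPow (b - a) y * (bracketPow (-b) x * bracketPow (-b) y) := by gcongr
    _ = bracketPow (-a) y * bracketPow (-b) x := by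
        rw [mul_left_comm, ← bracketPow_add, mul_comm]
        ring_nf

theorem bracketPow_mul_le_sum_resonantWeight {a b R x y z : ℝ} (hab : a ≤ b)
    (hR : R ≤ 2 * (bracket x + bracket y + bracket z) + 2) :
    bracketPow (-a) x * (bracketPow (-b) y * bracketPow (-b) z) ≤
      resonantWeight a b R x y z + resonantWeight a b R y x z + resonantWeight a b R z x y := by
  have hx := one_le_bracket x
  have hW : ∀ {u v w : ℝ}, R ≤ 8 * bracket u → resonantWeight a b R u v w =
      bracketPow (-a) u * (bracketPow (-b) v * bracketPow (-b) w) := fun h => if_pos h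
  have hmax : bracket y ≤ bracket x ∧ bracket z ≤ bracket x ∨
      bracket x ≤ bracket y ∧ bracket z ≤ bracket y ∨
      bracket x ≤ bracket z ∧ bracket y ≤ bracket z := by grind
  rcases hmax with ⟨hyx, hzx⟩ | ⟨hxy, hzy⟩ | ⟨hxz, hyz⟩
  · rw [hW (u := x) (by linarith)]
    exact le_self_add.trans le_self_add
  · refine le_trans ?_ (le_add_self.trans le_self_add)
    calc _ = bracketPow (-a) x * bracketPow (-b) y * bracketPow (-b) z := by ring
      _ ≤ bracketPow (-a) y * bracketPow (-b) x * bracketPow (-b) z :=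
        mul_le_mul' (bracketPow_mul_swap_le hab hxy) le_rfl
      _ = _ := by rw [hW (by linarith), mul_assoc]
  · refine le_trans ?_ le_add_self
    calc _ = bracketPow (-a) x * bracketPow (-b) z * bracketPow (-b) y := by ring
      _ ≤ bracketPow (-a) z * bracketPow (-b) x * bracketPow (-b) y :=
        mul_le_mul' (bracketPow_mul_swap_le hab hxz) le_rfl
      _ = _ := by rw [hW (by linarith), mul_assoc]

section Bilinear

variable {G : Type*} [MeasurableSpace G] {μ : Measure G}

theorem sq_lintegral_mul_le {f g : G → ℝ≥0∞} (hf : AEMeasurable f μ) (hg : AEMeasurable g μ) :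
    (∫⁻ x, f x * g x ∂μ) ^ 2 ≤ (∫⁻ x, f x ^ 2 ∂μ) * ∫⁻ x, g x ^ 2 ∂μ := by
  have h := pow_le_pow_left'
    (ENNReal.lintegral_mul_le_Lp_mul_Lq μ Real.HolderConjugate.two_two hf hg) 2
  rw [mul_pow, ← ENNReal.rpow_mul_natCast, ← ENNReal.rpow_mul_natCast] at h
  simpa using h

theorem add_add_sq_le (x y z : ℝ≥0∞) : (x + y + z) ^ 2 ≤ 3 * (x ^ 2 + y ^ 2 + z ^ 2) := by
  have h := ENNReal.rpow_sum_le_const_mul_sum_rpow Finset.univ ![x, y, z] (p := 2) one_le_two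
  norm_num [Fin.sum_univ_three] at h
  exact_mod_cast h

variable [AddCommGroup G] [MeasurableAdd₂ G] [MeasurableNeg G] [SFinite μ] [μ.IsAddLeftInvariant]
  {K : G → G → ℝ≥0∞} {V M : G → ℝ≥0∞} {C : ℝ≥0∞}

theorem lintegral_sq_bilinear_le_of_out (hK : Measurable fun x : G × G => K x.1 x.2)
    (hV : Measurable V) (hM : Measurable M) (hC : ∀ ζ, ∫⁻ η, K ζ η ^ 2 ∂μ ≤ C) :
    ∫⁻ ζ, (∫⁻ η, K ζ η * (V (ζ - η) * M η) ∂μ) ^ 2 ∂μ ≤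
      C * (∫⁻ ζ, V ζ ^ 2 ∂μ) * ∫⁻ η, M η ^ 2 ∂μ := by
  have hK' : ∀ ζ, Measurable (K ζ) := fun ζ => hK.comp measurable_prodMk_left
  calc _ ≤ ∫⁻ ζ, C * ∫⁻ η, V (ζ - η) ^ 2 * M η ^ 2 ∂μ ∂μ := by
        refine lintegral_mono fun ζ => ?_
        refine (sq_lintegral_mul_le (hK' ζ).aemeasurable (by fun_prop)).trans ?_
        simp_rw [mul_pow]
        gcongr
        exact hC ζ
    _ = C * ∫⁻ η, ∫⁻ ζ, V (ζ - η) ^ 2 * M η ^ 2 ∂μ ∂μ := by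
        rw [lintegral_const_mul _ (by fun_prop), lintegral_lintegral_swap (by fun_prop)]
    _ = C * ∫⁻ η, (∫⁻ ζ, V ζ ^ 2 ∂μ) * M η ^ 2 ∂μ := by
        congr! 3 with η
        rw [lintegral_mul_const _ (by fun_prop), lintegral_sub_right_eq_self (fun ζ => V ζ ^ 2) η]
    _ = _ := by rw [lintegral_const_mul _ (by fun_prop), mul_assoc]

variable [μ.IsNegInvariant]

theorem lintegral_sq_bilinear_le_of_right (hK : Measurable fun x : G × G => K x.1 x.2)
    (hV : Measurable V) (hM : Measurable M) (hC : ∀ η, ∫⁻ ζ, K ζ η ^ 2 ∂μ ≤ C) :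
    ∫⁻ ζ, (∫⁻ η, K ζ η * (V (ζ - η) * M η) ∂μ) ^ 2 ∂μ ≤
      C * (∫⁻ ζ, V ζ ^ 2 ∂μ) * ∫⁻ η, M η ^ 2 ∂μ := by
  have hK' : ∀ ζ, Measurable (K ζ) := fun ζ => hK.comp measurable_prodMk_left
  have hK'' : ∀ η, Measurable fun ζ => K ζ η := fun η => hK.comp measurable_prodMk_right
  have hcs : ∀ ζ, (∫⁻ η, K ζ η * (V (ζ - η) * M η) ∂μ) ^ 2 ≤
      (∫⁻ ζ, V ζ ^ 2 ∂μ) * ∫⁻ η, K ζ η ^ 2 * M η ^ 2 ∂μ := fun ζ => by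
    have h := sq_lintegral_mul_le (μ := μ) (f := fun η => V (ζ - η)) (g := fun η => K ζ η * M η)
      (by fun_prop) ((hK' ζ).mul hM).aemeasurable
    simpa only [lintegral_sub_left_eq_self (fun ζ => V ζ ^ 2) ζ, mul_pow,
      mul_left_comm (V _)] using h
  calc _ ≤ ∫⁻ ζ, (∫⁻ ζ, V ζ ^ 2 ∂μ) * ∫⁻ η, K ζ η ^ 2 * M η ^ 2 ∂μ ∂μ := lintegral_mono hcs
    _ = (∫⁻ ζ, V ζ ^ 2 ∂μ) * ∫⁻ η, ∫⁻ ζ, K ζ η ^ 2 * M η ^ 2 ∂μ ∂μ := by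
        rw [lintegral_const_mul _ (by fun_prop), lintegral_lintegral_swap (by fun_prop)]
    _ ≤ (∫⁻ ζ, V ζ ^ 2 ∂μ) * ∫⁻ η, C * M η ^ 2 ∂μ := by
        gcongr with η
        rw [lintegral_mul_const _ ((hK'' η).pow_const 2)]
        gcongr
        exact hC η
    _ = _ := by rw [lintegral_const_mul _ (by fun_prop)]; ring

theorem lintegral_sq_bilinear_le_of_left (hK : Measurable fun x : G × G => K x.1 x.2)
    (hV : Measurable V) (hM : Measurable M) (hC : ∀ η, ∫⁻ ζ, K ζ (ζ - η) ^ 2 ∂μ ≤ C) :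
    ∫⁻ ζ, (∫⁻ η, K ζ η * (V (ζ - η) * M η) ∂μ) ^ 2 ∂μ ≤
      C * (∫⁻ ζ, V ζ ^ 2 ∂μ) * ∫⁻ η, M η ^ 2 ∂μ := by
  have h := lintegral_sq_bilinear_le_of_right (K := fun ζ η => K ζ (ζ - η))
    (hK.comp (measurable_fst.prodMk (measurable_fst.sub measurable_snd))) hM hV hC
  rw [mul_right_comm]
  refine le_trans (le_of_eq (lintegral_congr fun ζ => ?_)) h
  rw [← lintegral_sub_left_eq_self _ ζ]
  simp only [sub_sub_cancel, mul_comm (V _)]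

theorem lintegral_sq_bilinear_le_of_add {K₁ K₂ K₃ : G → G → ℝ≥0∞}
    (hK₁ : Measurable fun x : G × G => K₁ x.1 x.2) (hK₂ : Measurable fun x : G × G => K₂ x.1 x.2)
    (hK₃ : Measurable fun x : G × G => K₃ x.1 x.2) (hV : Measurable V) (hM : Measurable M)
    (hC₁ : ∀ ζ, ∫⁻ η, K₁ ζ η ^ 2 ∂μ ≤ C) (hC₂ : ∀ η, ∫⁻ ζ, K₂ ζ (ζ - η) ^ 2 ∂μ ≤ C)
    (hC₃ : ∀ η, ∫⁻ ζ, K₃ ζ η ^ 2 ∂μ ≤ C) :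
    ∫⁻ ζ, (∫⁻ η, (K₁ ζ η + K₂ ζ η + K₃ ζ η) * (V (ζ - η) * M η) ∂μ) ^ 2 ∂μ ≤
      9 * C * (∫⁻ ζ, V ζ ^ 2 ∂μ) * ∫⁻ η, M η ^ 2 ∂μ := by
  have hm₁ : ∀ ζ, Measurable (K₁ ζ) := fun ζ => hK₁.comp measurable_prodMk_left
  have hm₂ : ∀ ζ, Measurable (K₂ ζ) := fun ζ => hK₂.comp measurable_prodMk_left
  calc _ ≤ ∫⁻ ζ, 3 * ((∫⁻ η, K₁ ζ η * (V (ζ - η) * M η) ∂μ) ^ 2 +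
          (∫⁻ η, K₂ ζ η * (V (ζ - η) * M η) ∂μ) ^ 2 +
          (∫⁻ η, K₃ ζ η * (V (ζ - η) * M η) ∂μ) ^ 2) ∂μ := by
        refine lintegral_mono fun ζ => ?_
        simp only [add_mul]
        rw [lintegral_add_left (by fun_prop), lintegral_add_left (by fun_prop)]
        exact add_add_sq_le _ _ _
    _ = 3 * ((∫⁻ ζ, (∫⁻ η, K₁ ζ η * (V (ζ - η) * M η) ∂μ) ^ 2 ∂μ) +
          (∫⁻ ζ, (∫⁻ η, K₂ ζ η * (V (ζ - η) * M η) ∂μ) ^ 2 ∂μ) +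
          ∫⁻ ζ, (∫⁻ η, K₃ ζ η * (V (ζ - η) * M η) ∂μ) ^ 2 ∂μ) := by
        rw [lintegral_const_mul _ (by fun_prop), lintegral_add_left (by fun_prop),
          lintegral_add_left (by fun_prop)]
    _ ≤ 3 * (C * (∫⁻ ζ, V ζ ^ 2 ∂μ) * (∫⁻ η, M η ^ 2 ∂μ) +
          C * (∫⁻ ζ, V ζ ^ 2 ∂μ) * (∫⁻ η, M η ^ 2 ∂μ) +
          C * (∫⁻ ζ, V ζ ^ 2 ∂μ) * ∫⁻ η, M η ^ 2 ∂μ) := by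
        gcongr
        · exact lintegral_sq_bilinear_le_of_out hK₁ hV hM hC₁
        · exact lintegral_sq_bilinear_le_of_left hK₂ hV hM hC₂
        · exact lintegral_sq_bilinear_le_of_right hK₃ hV hM hC₃
    _ = _ := by ring

end Bilinear

section Growth

variable {E : Type*} [NormedAddCommGroup E] [NormedSpace ℝ E]

theorem quadraticGrowth_norm_sq_add {k : E → ℝ} (hk : LipschitzWith 1 k) :
    QuadraticGrowth fun x => ‖x‖ ^ 2 + k x := by
  intro ω hω s (hs : 1 ≤ s) r _ hsr
  have hk' : k (s • ω) - k (r • ω) ≤ r - s :=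
    calc k (s • ω) - k (r • ω) ≤ dist (s • ω) (r • ω) :=
          (le_abs_self _).trans (by simpa [Real.dist_eq] using hk.dist_le_mul (s • ω) (r • ω))
      _ = r - s := by
          rw [dist_comm, dist_eq_norm, ← sub_smul, norm_smul, hω, mul_one,
            Real.norm_of_nonneg (sub_nonneg.2 hsr)]
  simp only [norm_smul, hω, mul_one, Real.norm_eq_abs, sq_abs]
  nlinarith

theorem quadraticGrowth_two_mul_norm_sq_add_const (c : ℝ) :
    QuadraticGrowth fun x : E => 2 * ‖x‖ ^ 2 + c := by
  intro ω hω s (hs : 1 ≤ s) r _ hsr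
  simp only [norm_smul, hω, mul_one, Real.norm_eq_abs, sq_abs]
  nlinarith

end Growth

section SchrodingerWave

variable {d : ℕ} {a b : ℝ} {h : EuclideanSpace ℝ (Fin d) → ℝ}

theorem modulation_sub (ζ η : Spacetime d) :
    modulation h (ζ - η) = ζ.fst - (η.fst + h (ζ.snd - η.snd)) := by
  simp only [modulation, WithLp.sub_fst, WithLp.sub_snd, sub_sub]

theorem norm_sq_add_norm_sub_sq_le (hh : LipschitzWith 1 h) (h0 : h 0 = 0) (ζ η : Spacetime d) :
    ‖ζ.snd‖ ^ 2 + ‖ζ.snd - η.snd‖ ^ 2 ≤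
      2 * (bracket (modulation (‖·‖ ^ 2) ζ) + bracket (modulation hSchr (ζ - η)) +
        bracket (modulation h η)) + 2 := by
  have hη : h η.snd ≤ ‖ζ.snd‖ + ‖ζ.snd - η.snd‖ :=
    calc h η.snd ≤ ‖η.snd‖ := by
          simpa [h0] using (le_abs_self _).trans (hh.norm_sub_le η.snd 0)
      _ ≤ ‖ζ.snd‖ + ‖ζ.snd - η.snd‖ := by simpa using norm_sub_le ζ.snd (ζ.snd - η.snd)
  -- the resonance identity
  have hres : ‖ζ.snd‖ ^ 2 + ‖ζ.snd - η.snd‖ ^ 2 = -modulation (‖·‖ ^ 2) ζ +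
      modulation hSchr (ζ - η) + modulation h η + h η.snd := by
    simp only [modulation, hSchr, WithLp.sub_fst, WithLp.sub_snd]
    ring
  have hA := (neg_le_abs _).trans (abs_le_bracket (modulation (‖·‖ ^ 2) ζ))
  have hB := (le_abs_self _).trans (abs_le_bracket (modulation hSchr (ζ - η)))
  have hD := (le_abs_self _).trans (abs_le_bracket (modulation h η))
  nlinarith [sq_nonneg (‖ζ.snd‖ - 1), sq_nonneg (‖ζ.snd - η.snd‖ - 1)]

variable (hd : d ≠ 0) (hb : 0 ≤ b) (ha : ((d - 2 : ℕ) : ℝ) ≤ 4 * a)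
include hd hb ha

theorem lintegral_sq_resonantWeight_out_le (hh : LipschitzWith 1 h) (ζ : Spacetime d) (x : ℝ) :
    ∫⁻ η : Spacetime d, resonantWeight a b (‖ζ.snd‖ ^ 2 + ‖ζ.snd - η.snd‖ ^ 2) x
      (modulation hSchr (ζ - η)) (modulation h η) ^ 2 ≤ resonanceConst d (2 * b) := by
  set α : EuclideanSpace ℝ (Fin d) → ℝ := fun ξ => ζ.fst - h (ζ.snd - ξ)
  have hα : LipschitzWith 1 α := LipschitzWith.of_dist_le_mul fun ξ ξ' => by
    simpa only [α, dist_sub_left] using hh.dist_le_mul (ζ.snd - ξ) (ζ.snd - ξ')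
  have hgrow : QuadraticGrowth fun ξ => α (ξ + 0) - hSchr (ξ + 0) := by
    simpa [hSchr, add_comm] using quadraticGrowth_norm_sq_add hα
  refine le_trans (le_of_eq ?_) (lintegral_sq_resonantWeight_le hd hb ha hα.continuous.measurable
    (by unfold hSchr; fun_prop) hgrow (R := fun ξ => ‖ζ.snd‖ ^ 2 + ‖ξ‖ ^ 2) (by simp) x)
  rw [← lintegral_sub_left_eq_self _ ζ]
  refine lintegral_congr fun η => ?_
  have hmod : modulation h (ζ - η) = -modulation α η := by rw [modulation_sub, modulation]; ring
  rw [sub_sub_cancel, hmod, resonantWeight_neg_right, resonantWeight_swap, WithLp.sub_snd,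
    sub_sub_cancel]

theorem lintegral_sq_resonantWeight_left_le (hh : LipschitzWith 1 h) (η : Spacetime d) (y : ℝ) :
    ∫⁻ ζ : Spacetime d, resonantWeight a b (‖ζ.snd‖ ^ 2 + ‖ζ.snd - (ζ - η).snd‖ ^ 2) y
      (modulation (‖·‖ ^ 2) ζ) (modulation h (ζ - η)) ^ 2 ≤ resonanceConst d (2 * b) := by
  set β : EuclideanSpace ℝ (Fin d) → ℝ := fun ξ => η.fst + h (ξ - η.snd)
  have hβ : LipschitzWith 1 β := LipschitzWith.of_dist_le_mul fun ξ ξ' => by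
    simpa [β] using hh.dist_le_mul (ξ - η.snd) (ξ' - η.snd)
  have hgrow : QuadraticGrowth fun ξ : EuclideanSpace ℝ (Fin d) => ‖ξ + 0‖ ^ 2 - β (ξ + 0) := by
    simpa [sub_eq_add_neg] using quadraticGrowth_norm_sq_add hβ.neg
  refine le_trans (le_of_eq ?_) (lintegral_sq_resonantWeight_le hd hb ha (α := (‖·‖ ^ 2))
    (by fun_prop) hβ.continuous.measurable hgrow (R := fun ξ => ‖ξ‖ ^ 2 + ‖η.snd‖ ^ 2)
    (by simp) y)
  refine lintegral_congr fun ζ => ?_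
  rw [modulation_sub, WithLp.sub_snd, sub_sub_cancel]
  rfl

theorem lintegral_sq_resonantWeight_right_le (η : Spacetime d) (z : ℝ) :
    ∫⁻ ζ : Spacetime d, resonantWeight a b (‖ζ.snd‖ ^ 2 + ‖ζ.snd - η.snd‖ ^ 2) z
      (modulation (‖·‖ ^ 2) ζ) (modulation hSchr (ζ - η)) ^ 2 ≤ resonanceConst d (2 * b) := by
  set c : EuclideanSpace ℝ (Fin d) := (1 / 2 : ℝ) • η.snd
  set β : EuclideanSpace ℝ (Fin d) → ℝ := fun ξ => η.fst - ‖ξ - η.snd‖ ^ 2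
  have hcc : c + c = η.snd := by rw [← two_smul ℝ, smul_smul]; norm_num
  have hpar : ∀ ξ : EuclideanSpace ℝ (Fin d),
      ‖ξ + c‖ ^ 2 + ‖ξ + c - η.snd‖ ^ 2 = 2 * ‖ξ‖ ^ 2 + 2 * ‖c‖ ^ 2 := fun ξ => by
    have hξ : ξ + c - η.snd = ξ - c := by rw [← hcc]; abel
    rw [hξ]
    linarith [parallelogram_law_with_norm ℝ ξ c]
  have hgrow : QuadraticGrowth fun ξ => ‖ξ + c‖ ^ 2 - β (ξ + c) := by
    have hβ : (fun ξ => ‖ξ + c‖ ^ 2 - β (ξ + c)) =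
        fun ξ => 2 * ‖ξ‖ ^ 2 + (2 * ‖c‖ ^ 2 - η.fst) := by
      funext ξ
      linarith [hpar ξ]
    rw [hβ]
    exact quadraticGrowth_two_mul_norm_sq_add_const _
  have hR : ∀ ξ, ‖ξ - c‖ ^ 2 ≤ ‖ξ‖ ^ 2 + ‖ξ - η.snd‖ ^ 2 := fun ξ => by
    have hξ := hpar (ξ - c)
    rw [sub_add_cancel] at hξ
    nlinarith [sq_nonneg ‖c‖, sq_nonneg ‖ξ - c‖]
  refine le_trans (le_of_eq (lintegral_congr fun ζ => ?_)) (lintegral_sq_resonantWeight_le hd hb ha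
    (α := (‖·‖ ^ 2)) (by fun_prop) (by fun_prop) hgrow hR z)
  rw [modulation_sub]
  rfl

theorem lintegral_sq_schrodinger_convolution_le (hab : a ≤ b) (hh : LipschitzWith 1 h)
    (h0 : h 0 = 0) {V M : Spacetime d → ℝ≥0∞} (hV : Measurable V) (hM : Measurable M) :
    ∫⁻ ζ : Spacetime d, (bracketPow (-a) (modulation (‖·‖ ^ 2) ζ) * ∫⁻ η, V (ζ - η) * M η) ^ 2 ≤
      9 * resonanceConst d (2 * b) * (∫⁻ ζ, (bracketPow b (modulation hSchr ζ) * V ζ) ^ 2) *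
        ∫⁻ η, (bracketPow b (modulation h η) * M η) ^ 2 := by
  have hhm := hh.continuous.measurable
  have hSm : Measurable (hSchr (d := d)) := by unfold hSchr; fun_prop
  have hSm' : Measurable fun ξ : EuclideanSpace ℝ (Fin d) => ‖ξ‖ ^ 2 := by fun_prop
  set X : Spacetime d → ℝ := modulation (‖·‖ ^ 2)
  set Y : Spacetime d → ℝ := modulation hSchr
  set Z : Spacetime d → ℝ := modulation h
  have hX : Measurable X := measurable_modulation hSm'
  have hY : Measurable Y := measurable_modulation hSm
  have hZ : Measurable Z := measurable_modulation hhm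
  set R : Spacetime d → Spacetime d → ℝ := fun ζ η => ‖ζ.snd‖ ^ 2 + ‖ζ.snd - η.snd‖ ^ 2
  have hR : Measurable fun x : Spacetime d × Spacetime d => R x.1 x.2 := by fun_prop
  have hsplit : ∀ ζ η, bracketPow (-a) (X ζ) * (V (ζ - η) * M η) ≤
      (resonantWeight a b (R ζ η) (X ζ) (Y (ζ - η)) (Z η) +
        resonantWeight a b (R ζ η) (Y (ζ - η)) (X ζ) (Z η) +
        resonantWeight a b (R ζ η) (Z η) (X ζ) (Y (ζ - η))) *
      ((bracketPow b (Y (ζ - η)) * V (ζ - η)) * (bracketPow b (Z η) * M η)) := fun ζ η =>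
    calc bracketPow (-a) (X ζ) * (V (ζ - η) * M η)
        = bracketPow (-a) (X ζ) *
            ((bracketPow (-b) (Y (ζ - η)) * bracketPow b (Y (ζ - η)) * V (ζ - η)) *
              (bracketPow (-b) (Z η) * bracketPow b (Z η) * M η)) := by
          simp only [bracketPow_neg_mul_self, one_mul]
      _ = bracketPow (-a) (X ζ) * (bracketPow (-b) (Y (ζ - η)) * bracketPow (-b) (Z η)) *
            ((bracketPow b (Y (ζ - η)) * V (ζ - η)) * (bracketPow b (Z η) * M η)) := by ring
      _ ≤ _ := by
          gcongr
          exact bracketPow_mul_le_sum_resonantWeight hab (norm_sq_add_norm_sub_sq_le hh h0 ζ η)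
  refine (lintegral_mono fun ζ => pow_le_pow_left' ?_ 2).trans
    (lintegral_sq_bilinear_le_of_add
      (K₁ := fun ζ η => resonantWeight a b (R ζ η) (X ζ) (Y (ζ - η)) (Z η))
      (K₂ := fun ζ η => resonantWeight a b (R ζ η) (Y (ζ - η)) (X ζ) (Z η))
      (K₃ := fun ζ η => resonantWeight a b (R ζ η) (Z η) (X ζ) (Y (ζ - η)))
      (by fun_prop) (by fun_prop) (by fun_prop) (by fun_prop) (by fun_prop)
      (fun ζ => lintegral_sq_resonantWeight_out_le hd hb ha hh ζ _)
      (fun η => by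
        simpa only [sub_sub_cancel] using lintegral_sq_resonantWeight_left_le hd hb ha hh η (Y η))
      fun η => lintegral_sq_resonantWeight_right_le hd hb ha η _)
  rw [← lintegral_const_mul _ (by fun_prop)]
  exact lintegral_mono (hsplit ζ)

end SchrodingerWave

section ConvolutionTheorem

variable {E : Type*} [NormedAddCommGroup E] [InnerProductSpace ℝ E] [FiniteDimensional ℝ E]
  [MeasurableSpace E] [BorelSpace E] {G H : E → ℂ}

theorem memLp_comp_sub_left {p : ℝ≥0∞} (hG : MemLp G p) (κ : E) : MemLp (fun ζ => G (κ - ζ)) p :=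
  hG.comp_measurePreserving (Measure.measurePreserving_sub_left volume κ)

theorem lintegral_enorm_convolution_le (hG : MemLp G 2) (hH : MemLp H 2) (κ : E) :
    ∫⁻ ζ, ‖G (κ - ζ) * H ζ‖ₑ ≤ eLpNorm G 2 * eLpNorm H 2 := by
  have h := eLpNorm_smul_le_mul_eLpNorm (p := 2) (q := 2) (r := 1) hH.1 (memLp_comp_sub_left hG κ).1
  rw [eLpNorm_one_eq_lintegral_enorm] at h
  exact h.trans_eq (congrArg (· * _) (eLpNorm_comp_measurePreserving hG.1
    (Measure.measurePreserving_sub_left volume κ)))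

theorem norm_integral_le_of_norm_le_convolution (hG : MemLp G 2) (hH : MemLp H 2) {κ : E}
    {f : E → ℂ} (hf : ∀ ζ, ‖f ζ‖ ≤ ‖G (κ - ζ) * H ζ‖) :
    ‖∫ ζ, f ζ‖ ≤ (eLpNorm G 2).toReal * (eLpNorm H 2).toReal := by
  rw [← ENNReal.toReal_mul, ← toReal_enorm]
  refine ENNReal.toReal_mono (ENNReal.mul_lt_top hG.2 hH.2).ne ?_
  calc ‖∫ ζ, f ζ‖ₑ ≤ ∫⁻ ζ, ‖f ζ‖ₑ := enorm_integral_le_lintegral_enorm _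
    _ ≤ ∫⁻ ζ, ‖G (κ - ζ) * H ζ‖ₑ := lintegral_mono fun ζ => enorm_le_iff_norm_le.2 (hf ζ)
    _ ≤ _ := lintegral_enorm_convolution_le hG hH κ

theorem aestronglyMeasurable_convolution_integrand (hG : AEStronglyMeasurable G)
    (hH : AEStronglyMeasurable H) :
    AEStronglyMeasurable (fun x : E × E => G (x.1 - x.2) * H x.2) (volume.prod volume) := by
  simpa [mul_comm] using hH.convolution_integrand (ContinuousLinearMap.mul ℝ ℂ) hG

theorem memLp_top_convolution (hG : MemLp G 2) (hH : MemLp H 2) :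
    MemLp (fun κ => ∫ ζ, G (κ - ζ) * H ζ) ∞ :=
  memLp_top_of_bound
    (aestronglyMeasurable_convolution_integrand hG.1 hH.1).integral_prod_right' _
    (.of_forall fun _ => norm_integral_le_of_norm_le_convolution hG hH fun _ => le_rfl)

theorem integral_integral_convolution_swap {f : E → ℂ} (hf : Integrable f) (hG : MemLp G 2)
    (hH : MemLp H 2) :
    ∫ ζ, (∫ κ, f κ * G (κ - ζ)) * H ζ = ∫ κ, f κ * ∫ ζ, G (κ - ζ) * H ζ := by
  have hmeas : AEStronglyMeasurable (fun x : E × E => f x.1 * (G (x.1 - x.2) * H x.2))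
      (volume.prod volume) :=
    hf.1.comp_fst.mul (aestronglyMeasurable_convolution_integrand hG.1 hH.1)
  have hint : Integrable (fun x : E × E => f x.1 * (G (x.1 - x.2) * H x.2))
      (volume.prod volume) := by
    refine ⟨hmeas, ?_⟩
    rw [HasFiniteIntegral, lintegral_prod _ hmeas.enorm]
    calc _ ≤ ∫⁻ κ, ‖f κ‖ₑ * (eLpNorm G 2 * eLpNorm H 2) := by
          refine lintegral_mono fun κ => ?_
          simp only [enorm_mul (f κ)]
          rw [lintegral_const_mul' _ _ enorm_ne_top]
          gcongr
          exact lintegral_enorm_convolution_le hG hH κ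
      _ < ∞ := by
          rw [lintegral_mul_const'' _ hf.1.enorm]
          exact ENNReal.mul_lt_top hf.2 (ENNReal.mul_lt_top hG.2 hH.2)
  simp only [← integral_mul_const, ← integral_const_mul, mul_assoc]
  exact (integral_integral_swap (f := fun κ ζ => f κ * (G (κ - ζ) * H ζ)) hint).symm

theorem continuous_integral_mul_Lp {k : E → ℂ} (hk : MemLp k 2) :
    Continuous fun U : Lp ℂ 2 (volume : Measure E) => ∫ z, k z * U z := by
  have hinner : (fun U : Lp ℂ 2 (volume : Measure E) => ∫ z, k z * U z) =
      fun U => inner ℂ (hk.star.toLp _) U := by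
    ext U
    rw [L2.inner_def]
    refine integral_congr_ae ?_
    filter_upwards [hk.star.coeFn_toLp] with z hz
    rw [hz, RCLike.inner_apply]
    simp [mul_comm]
  rw [hinner]
  fun_prop

theorem continuous_integral_mul_convolution {f : E → ℂ} (hf : Integrable f) (hH : MemLp H 2) :
    Continuous fun G : Lp ℂ 2 (volume : Measure E) => ∫ κ, f κ * ∫ ζ, G (κ - ζ) * H ζ := by
  rw [continuous_iff_continuousAt]
  intro G₀
  refine continuousAt_of_dominated (bound := fun κ => ‖f κ‖ * ((‖G₀‖ + 1) * (eLpNorm H 2).toReal))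
    ?_ ?_ (hf.norm.mul_const _) ?_
  · exact .of_forall fun G => hf.1.mul (memLp_top_convolution (Lp.memLp G) hH).1
  · filter_upwards [(continuous_norm.tendsto G₀).eventually_lt_const (lt_add_one ‖G₀‖)] with G hG
    refine .of_forall fun κ => ?_
    rw [norm_mul]
    gcongr
    refine (norm_integral_le_of_norm_le_convolution (Lp.memLp G) hH fun _ => le_rfl).trans ?_
    rw [← Lp.norm_def]
    gcongr
  · refine .of_forall fun κ => ContinuousAt.mul continuousAt_const ?_
    have hswap : ∀ G : Lp ℂ 2 (volume : Measure E),
        ∫ ζ, G (κ - ζ) * H ζ = ∫ ζ, H (κ - ζ) * G ζ := fun G => by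
      rw [← integral_sub_left_eq_self _ volume κ]
      simp only [sub_sub_cancel, mul_comm]
    simp only [hswap]
    exact (continuous_integral_mul_Lp (memLp_comp_sub_left hH κ)).continuousAt

theorem integral_fourier_mul_Lp (χ : 𝓢(E, ℂ)) (W : Lp ℂ 2 (volume : Measure E)) :
    ∫ z, 𝓕 χ z * W z = ∫ ζ, χ ζ * (𝓕 W : Lp ℂ 2 (volume : Measure E)) ζ := by
  simpa [TemperedDistribution.fourier_apply] using
    DFunLike.congr_fun (Lp.fourier_toTemperedDistribution_eq W) χ

theorem exists_fourier_eq_mul_fourierInv (φ g : 𝓢(E, ℂ)) :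
    ∃ χ : 𝓢(E, ℂ), (∀ z, 𝓕 χ z = 𝓕 φ z * 𝓕⁻ g z) ∧ ∀ ζ, χ ζ = ∫ κ, φ κ * g (κ - ζ) := by
  set ψ : 𝓢(E, ℂ) := compCLMOfContinuousLinearEquiv ℂ (ContinuousLinearEquiv.neg ℝ) g
  have hψ : ∀ x, ψ x = g (-x) := fun x => rfl
  have hψF : ∀ z, 𝓕⁻ g z = 𝓕 ψ z := fun z => by
    rw [fourierInv_coe, fourier_coe, Real.fourierInv_eq_fourier_comp_neg]
    rfl
  refine ⟨SchwartzMap.convolution (ContinuousLinearMap.mul ℂ ℂ) φ ψ, fun z => ?_, fun ζ => ?_⟩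
  · rw [SchwartzMap.fourier_convolution, hψF]
    simp
  · rw [SchwartzMap.convolution_apply, convolution_def]
    simp [hψ]

theorem integral_fourier_mul_fourierInv_mul_Lp (φ g : 𝓢(E, ℂ))
    (W : Lp ℂ 2 (volume : Measure E)) :
    ∫ z, 𝓕 φ z * (𝓕⁻ g z * W z) =
      ∫ κ, φ κ * ∫ ζ, g (κ - ζ) * (𝓕 W : Lp ℂ 2 (volume : Measure E)) ζ := by
  obtain ⟨χ, hχF, hχ⟩ := exists_fourier_eq_mul_fourierInv φ g
  rw [← integral_integral_convolution_swap φ.integrable (g.memLp 2) (Lp.memLp _)]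
  simpa only [hχF, hχ, mul_assoc] using integral_fourier_mul_Lp χ W

theorem integral_fourier_mul_Lp_mul_Lp (φ : 𝓢(E, ℂ)) (U W : Lp ℂ 2 (volume : Measure E)) :
    ∫ z, 𝓕 φ z * (U z * W z) =
      ∫ κ, φ κ * ∫ ζ, (𝓕 U : Lp ℂ 2 (volume : Measure E)) (κ - ζ) *
        (𝓕 W : Lp ℂ 2 (volume : Measure E)) ζ := by
  suffices h : ∀ G : Lp ℂ 2 (volume : Measure E),
      ∫ z, 𝓕 φ z * ((𝓕⁻ G : Lp ℂ 2 (volume : Measure E)) z * W z) =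
        ∫ κ, φ κ * ∫ ζ, G (κ - ζ) * (𝓕 W : Lp ℂ 2 (volume : Measure E)) ζ by
    simpa using h (𝓕 U)
  intro G
  refine (SchwartzMap.denseRange_toLpCLM (p := 2) (μ := (volume : Measure E))
    ENNReal.ofNat_ne_top).induction_on G ?_ fun g => ?_
  · refine isClosed_eq ?_ (continuous_integral_mul_convolution φ.integrable (Lp.memLp _))
    have hW : MemLp (fun z => 𝓕 φ z * W z) 2 := (Lp.memLp W).mul' ((𝓕 φ).memLp ∞)
    have hinv : Continuous fun G : Lp ℂ 2 (volume : Measure E) => 𝓕⁻ G :=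
      (Lp.fourierTransformₗᵢ E ℂ).symm.continuous
    simpa only [Function.comp_def, mul_assoc, mul_comm (W _)] using
      (continuous_integral_mul_Lp hW).comp hinv
  · have hconv : ∀ κ, (fun ζ => g.toLp 2 volume (κ - ζ)) =ᵐ[volume] fun ζ => g (κ - ζ) := fun κ =>
      (Measure.measurePreserving_sub_left volume κ).quasiMeasurePreserving.ae_eq_comp
        (g.coeFn_toLp 2 volume)
    calc ∫ z, 𝓕 φ z * ((𝓕⁻ (g.toLp 2 volume) : Lp ℂ 2 (volume : Measure E)) z * W z)
        = ∫ z, 𝓕 φ z * (𝓕⁻ g z * W z) := by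
          rw [toLp_fourierInv_eq]
          refine integral_congr_ae ?_
          filter_upwards [(𝓕⁻ g).coeFn_toLp 2 volume] with z hz
          rw [hz]
      _ = ∫ κ, φ κ * ∫ ζ, g (κ - ζ) * (𝓕 W : Lp ℂ 2 (volume : Measure E)) ζ :=
          integral_fourier_mul_fourierInv_mul_Lp φ g W
      _ = _ := by
          refine integral_congr_ae (.of_forall fun κ => congrArg (φ κ * ·) (integral_congr_ae ?_))
          filter_upwards [hconv κ] with ζ hζ
          rw [← hζ]
          rfl

end ConvolutionTheorem

section Distributions

variable {d : ℕ} {f f' f'' p p' : 𝓢'(Spacetime d, ℂ)} {u u' g g' : Spacetime d → ℂ}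

theorem IsFunction.locallyIntegrable (h : IsFunction f u) : LocallyIntegrable u := by
  intro x
  let β : ContDiffBump x := ⟨1, 2, one_pos, one_lt_two⟩
  have hβ₁ : HasCompactSupport (Complex.ofRealCLM ∘ β) := β.hasCompactSupport.comp_left rfl
  have hβ₂ : ContDiff ℝ (⊤ : ℕ∞) (Complex.ofRealCLM ∘ β) :=
    Complex.ofRealCLM.contDiff.comp β.contDiff
  refine ⟨Metric.closedBall x 1, Metric.closedBall_mem_nhds x one_pos, ?_⟩
  have hint := (h.2 (hβ₁.toSchwartzMap hβ₂)).1.integrableOn (s := Metric.closedBall x 1)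
  refine hint.congr_fun (fun z hz => ?_) measurableSet_closedBall
  have hβz : β z = 1 := β.one_of_mem_closedBall hz
  simp [hβz]

theorem IsFunction.ae_eq (h : IsFunction f u) (h' : IsFunction f u') : u =ᵐ[volume] u' := by
  refine ae_eq_of_integral_contDiff_smul_eq h.locallyIntegrable h'.locallyIntegrable ?_
  intro φ φ_smooth φ_cpt
  have hφ₁ : HasCompactSupport (Complex.ofRealCLM ∘ φ) := φ_cpt.comp_left rfl
  have hφ₂ : ContDiff ℝ (⊤ : ℕ∞) (Complex.ofRealCLM ∘ φ) :=
    Complex.ofRealCLM.contDiff.comp φ_smooth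
  simpa using (h.2 (hφ₁.toSchwartzMap hφ₂)).2.symm.trans (h'.2 (hφ₁.toSchwartzMap hφ₂)).2

theorem IsFunction.congr (h : IsFunction f u) (hu : u =ᵐ[volume] u') : IsFunction f u' := by
  refine ⟨h.1.congr hu, fun φ => ?_⟩
  have hφ : (fun z => φ z * u z) =ᵐ[volume] fun z => φ z * u' z := by
    filter_upwards [hu] with z hz
    rw [hz]
  exact ⟨(h.2 φ).1.congr hφ, (h.2 φ).2.trans (integral_congr_ae hφ)⟩

theorem IsFunction.unique (h : IsFunction f u) (h' : IsFunction f' u) : f = f' := by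
  ext φ
  rw [(h.2 φ).2, (h'.2 φ).2]

theorem IsFunction.sub (h : IsFunction f u) (h' : IsFunction f' u') :
    IsFunction (f - f') (fun z => u z - u' z) := by
  refine ⟨h.1.sub h'.1, fun φ => ?_⟩
  simp only [mul_sub]
  rw [integral_sub (h.2 φ).1 (h'.2 φ).1, ← (h.2 φ).2, ← (h'.2 φ).2]
  exact ⟨(h.2 φ).1.sub (h'.2 φ).1, rfl⟩

theorem integrable_schwartz_mul (φ : 𝓢(Spacetime d, ℂ)) {r : ℝ≥0∞} (hr : 1 ≤ r)
    (hu : MemLp u r) : Integrable fun z => φ z * u z :=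
  have := ENNReal.HolderConjugate.inv_one_sub_inv' hr
  (φ.memLp (1 - r⁻¹)⁻¹).integrable_mul hu

theorem isFunction_toTemperedDistribution {r : ℝ≥0∞} [hr : Fact (1 ≤ r)]
    (u : Lp ℂ r (volume : Measure (Spacetime d))) : IsFunction (u : 𝓢'(Spacetime d, ℂ)) u :=
  ⟨(Lp.memLp u).1, fun φ => ⟨integrable_schwartz_mul φ hr.out (Lp.memLp u), by simp⟩⟩

theorem exists_isFunction {r : ℝ≥0∞} (hr : 1 ≤ r) (hu : MemLp u r) :
    ∃ f : 𝓢'(Spacetime d, ℂ), IsFunction f u :=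
  have : Fact (1 ≤ r) := ⟨hr⟩
  ⟨_, (isFunction_toTemperedDistribution (hu.toLp u)).congr hu.coeFn_toLp⟩

theorem quasiMeasurePreserving_two_pi_smul :
    Measure.QuasiMeasurePreserving fun ζ : Spacetime d => (2 * Real.pi) • ζ :=
  Measure.quasiMeasurePreserving_smul _ Real.two_pi_pos.ne'

theorem quasiMeasurePreserving_inv_two_pi_smul :
    Measure.QuasiMeasurePreserving fun ζ : Spacetime d => (2 * Real.pi)⁻¹ • ζ :=
  Measure.quasiMeasurePreserving_smul _ (inv_ne_zero Real.two_pi_pos.ne')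

theorem memLp_comp_two_pi_smul {r : ℝ≥0∞} (hg : MemLp g r) :
    MemLp (fun ζ => g ((2 * Real.pi) • ζ)) r := by
  refine MemLp.comp_of_map ?_ (by fun_prop)
  rw [Measure.map_addHaar_smul _ Real.two_pi_pos.ne']
  exact hg.smul_measure ENNReal.ofReal_ne_top

theorem HasFourier.ae_eq (h : HasFourier f g) (h' : HasFourier f g') : g =ᵐ[volume] g' := by
  filter_upwards [quasiMeasurePreserving_inv_two_pi_smul.ae_eq_comp (IsFunction.ae_eq h h')]
    with ζ hζ
  simpa only [Function.comp_apply, smul_inv_smul₀ Real.two_pi_pos.ne'] using hζ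

theorem HasFourier.congr (h : HasFourier f g) (hg : g =ᵐ[volume] g') : HasFourier f g' :=
  IsFunction.congr h (quasiMeasurePreserving_two_pi_smul.ae_eq_comp hg)

theorem HasFourier.aestronglyMeasurable (h : HasFourier f g) : AEStronglyMeasurable g := by
  simpa only [Function.comp_def, smul_inv_smul₀ Real.two_pi_pos.ne'] using
    h.1.comp_quasiMeasurePreserving quasiMeasurePreserving_inv_two_pi_smul

theorem HasFourier.exists_stronglyMeasurable (h : HasFourier f g) :
    ∃ g', StronglyMeasurable g' ∧ HasFourier f g' :=
  ⟨_, h.aestronglyMeasurable.stronglyMeasurable_mk, h.congr h.aestronglyMeasurable.ae_eq_mk⟩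

theorem HasFourier.unique (h : HasFourier f g) (h' : HasFourier f' g) : f = f' := by
  simpa using congrArg (fun f : 𝓢'(Spacetime d, ℂ) => 𝓕⁻ f) (IsFunction.unique h h')

theorem HasFourier.sub (h : HasFourier f g) (h' : HasFourier f' g') :
    HasFourier (f - f') (fun ζ => g ζ - g' ζ) := by
  have hsub : 𝓕 (f - f') = 𝓕 f - 𝓕 f' := by
    ext φ
    rfl
  rw [HasFourier, hsub]
  exact IsFunction.sub h h'

theorem exists_hasFourier {r : ℝ≥0∞} (hr : 1 ≤ r) (hg : MemLp g r) :
    ∃ f : 𝓢'(Spacetime d, ℂ), HasFourier f g := by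
  obtain ⟨f, hf⟩ := exists_isFunction hr (memLp_comp_two_pi_smul hg)
  exact ⟨𝓕⁻ f, by rwa [HasFourier, FourierTransform.fourier_fourierInv_eq]⟩

theorem HasFourier.exists_Lp (h : HasFourier f g) (hg : MemLp g 2) :
    ∃ U : Lp ℂ 2 (volume : Measure (Spacetime d)), IsFunction f U ∧
      (𝓕 U : Lp ℂ 2 (volume : Measure (Spacetime d))) =ᵐ[volume]
        fun ζ => g ((2 * Real.pi) • ζ) := by
  have hg' := memLp_comp_two_pi_smul hg
  set G : Lp ℂ 2 (volume : Measure (Spacetime d)) := hg'.toLp _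
  have hfG : 𝓕 f = (G : 𝓢'(Spacetime d, ℂ)) :=
    IsFunction.unique h ((isFunction_toTemperedDistribution G).congr hg'.coeFn_toLp)
  have hf : f = ((𝓕⁻ G : Lp ℂ 2 (volume : Measure (Spacetime d))) : 𝓢'(Spacetime d, ℂ)) := by
    rw [← Lp.fourierInv_toTemperedDistribution_eq, ← hfG]
    simp
  refine ⟨𝓕⁻ G, ?_, ?_⟩
  · rw [hf]
    exact isFunction_toTemperedDistribution _
  · rw [FourierTransform.fourier_fourierInv_eq]
    exact hg'.coeFn_toLp

/-- The constant in the convolution theorem for the normalisation `HasFourier` of the Fourier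
transform. -/
def fourierConst (d : ℕ) : ℝ := ((2 * Real.pi) ^ (1 + d))⁻¹

theorem fourierConst_pos (d : ℕ) : 0 < fourierConst d := by
  unfold fourierConst
  positivity

theorem fourierConst_mul_integral (k : Spacetime d → ℂ) :
    (fourierConst d : ℂ) * ∫ η, k η = ∫ η, k ((2 * Real.pi) • η) := by
  have hrank : Module.finrank ℝ (Spacetime d) = 1 + d := by
    rw [(WithLp.linearEquiv 2 ℝ (ℝ × EuclideanSpace ℝ (Fin d))).finrank_eq]
    simp
  rw [Measure.integral_comp_smul_of_nonneg _ _ _ (hR := Real.two_pi_pos.le), Complex.real_smul,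
    fourierConst, hrank]

theorem exists_isProduct (h : HasFourier f g) (hg : MemLp g 2) (h' : HasFourier f' g')
    (hg' : MemLp g' 2) :
    ∃ p : 𝓢'(Spacetime d, ℂ), IsProduct f f' p ∧
      HasFourier p fun ζ => (fourierConst d : ℂ) * ∫ η, g (ζ - η) * g' η := by
  obtain ⟨U, hU, hUg⟩ := h.exists_Lp hg
  obtain ⟨W, hW, hWg⟩ := h'.exists_Lp hg'
  obtain ⟨p, hp⟩ := exists_isFunction le_rfl ((Lp.memLp W).mul' (Lp.memLp U) (r := 1))
  refine ⟨p, ⟨U, W, hU, hW, hp⟩, ?_⟩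
  have hconv : ∀ κ : Spacetime d, (fourierConst d : ℂ) * ∫ η, g ((2 * Real.pi) • κ - η) * g' η =
      ∫ ζ, (𝓕 U : Lp ℂ 2 (volume : Measure (Spacetime d))) (κ - ζ) *
        (𝓕 W : Lp ℂ 2 (volume : Measure (Spacetime d))) ζ := by
    intro κ
    rw [fourierConst_mul_integral]
    refine integral_congr_ae ?_
    have hUκ := (Measure.measurePreserving_sub_left volume κ).quasiMeasurePreserving.ae_eq_comp hUg
    filter_upwards [hUκ, hWg] with ζ hUζ hWζ
    simp only [Function.comp_apply] at hUζ
    rw [hUζ, hWζ, smul_sub]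
  have hbdd := memLp_top_convolution (Lp.memLp (𝓕 U : Lp ℂ 2 (volume : Measure (Spacetime d))))
    (Lp.memLp (𝓕 W : Lp ℂ 2 (volume : Measure (Spacetime d))))
  simp only [HasFourier, hconv]
  refine ⟨hbdd.1, fun φ => ⟨integrable_schwartz_mul φ le_top hbdd, ?_⟩⟩
  rw [TemperedDistribution.fourier_apply, (hp.2 _).2]
  exact integral_fourier_mul_Lp_mul_Lp φ U W

theorem IsProduct.unique (h : IsProduct f f' p) (h' : IsProduct f f' p') : p = p' := by
  obtain ⟨u, w, hu, hw, hp⟩ := h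
  obtain ⟨u', w', hu', hw', hp'⟩ := h'
  refine hp.unique (hp'.congr ?_)
  filter_upwards [hu.ae_eq hu', hw.ae_eq hw'] with z huz hwz
  rw [huz, hwz]

theorem IsMultiplier.hasFourier {a : EuclideanSpace ℝ (Fin d) → ℝ} (h : IsMultiplier a f f')
    (hg : HasFourier f g) : HasFourier f' fun ζ => (a ζ.snd : ℂ) * g ζ := by
  obtain ⟨g', hfg', hf'g'⟩ := h
  refine hf'g'.congr ?_
  filter_upwards [hfg'.ae_eq hg] with ζ hζ
  rw [hζ]

theorem IsMultiplier.unique {a : EuclideanSpace ℝ (Fin d) → ℝ} (h : IsMultiplier a f f')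
    (h' : IsMultiplier a f f'') : f' = f'' := by
  obtain ⟨g, hfg, hf'g⟩ := h
  exact hf'g.unique (h'.hasFourier hfg)

theorem IsCommutator.unique {σ : ℝ} {v m F F' : 𝓢'(Spacetime d, ℂ)} (h : IsCommutator σ v m F)
    (h' : IsCommutator σ v m F') : F = F' := by
  obtain ⟨p, w, q, r, hp, hw, hq, hr, rfl⟩ := h
  obtain ⟨p', w', q', r', hp', hw', hq', hr', rfl⟩ := h'
  obtain rfl := hp.unique hp'
  obtain rfl := IsMultiplier.unique hw hw'
  obtain rfl := hq.unique hq'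
  obtain rfl := IsMultiplier.unique hr hr'
  rfl

theorem conjSchwartz_fourier (φ : 𝓢(Spacetime d, ℂ)) :
    conjSchwartz (𝓕 φ) = 𝓕 (compCLMOfContinuousLinearEquiv ℂ (ContinuousLinearEquiv.neg ℝ)
      (conjSchwartz φ)) := by
  ext z
  change starRingEnd ℂ (𝓕 φ z) = _
  rw [fourier_coe, fourier_coe, Real.fourier_eq, Real.fourier_eq, ← integral_conj,
    ← integral_neg_eq_self]
  refine integral_congr_ae (.of_forall fun x => ?_)
  change _ = _ • conj (φ (-x))
  simp only [Circle.smul_def, smul_eq_mul, map_mul, inner_neg_left, neg_neg,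
    Real.fourierChar_apply, ← Complex.exp_conj, Complex.conj_I, Complex.conj_ofReal]
  congr 2
  push_cast
  ring

theorem HasFourier.conj (h : HasFourier f g) :
    HasFourier (conjDistribution f) fun ζ => conj (g (-ζ)) := by
  simp only [HasFourier, ← smul_neg]
  refine ⟨Complex.continuous_conj.comp_aestronglyMeasurable
    (h.1.comp_measurePreserving (Measure.measurePreserving_neg volume)), fun φ => ?_⟩
  set ψ : 𝓢(Spacetime d, ℂ) :=
    compCLMOfContinuousLinearEquiv ℂ (ContinuousLinearEquiv.neg ℝ) (conjSchwartz φ)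
  have hψ : ∀ ζ, ψ ζ = starRingEnd ℂ (φ (-ζ)) := fun ζ => rfl
  have hconj : ∀ ζ : Spacetime d, φ ζ * starRingEnd ℂ (g ((2 * Real.pi) • -ζ)) =
      starRingEnd ℂ (ψ (-ζ) * g ((2 * Real.pi) • -ζ)) := fun ζ => by simp [hψ]
  obtain ⟨hint, heq⟩ := h.2 ψ
  simp only [hconj]
  refine ⟨Complex.conjCLE.toContinuousLinearMap.integrable_comp hint.comp_neg, ?_⟩
  rw [integral_conj, integral_neg_eq_self (fun ζ => ψ ζ * g ((2 * Real.pi) • ζ)), ← heq,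
    TemperedDistribution.fourier_apply, TemperedDistribution.fourier_apply,
    ← conjSchwartz_fourier]
  rfl

end Distributions

section Norms

variable {d : ℕ} {h : EuclideanSpace ℝ (Fin d) → ℝ} {σ s b : ℝ} {f f' : 𝓢'(Spacetime d, ℂ)}

theorem bourgainNorm_eq {g : Spacetime d → ℂ} (hg : HasFourier f g) :
    bourgainNorm h s b f = eLpNorm (fun ζ : Spacetime d =>
      ((bracket ‖ζ.snd‖ ^ s * bracket (ζ.fst - h ζ.snd) ^ b : ℝ) : ℂ) * g ζ) 2 volume := by
  refine le_antisymm (iInf₂_le g hg) (le_iInf₂ fun g' hg' => le_of_eq (eLpNorm_congr_ae ?_))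
  filter_upwards [hg.ae_eq hg'] with ζ hζ
  rw [hζ]

theorem exists_hasFourier_of_bourgainNorm_lt_top (hf : bourgainNorm h s b f < ∞) :
    ∃ g, HasFourier f g := by
  by_contra! hc
  simp [bourgainNorm, hc] at hf

theorem gevreyBourgainNorm_eq (hf : IsExpD σ f f') :
    gevreyBourgainNorm h σ s b f = bourgainNorm h s b f' := by
  refine le_antisymm (iInf₂_le f' hf) (le_iInf₂ fun f'' hf'' => ?_)
  rw [IsMultiplier.unique hf hf'']

theorem exists_isExpD_of_gevreyBourgainNorm_lt_top (hf : gevreyBourgainNorm h σ s b f < ∞) :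
    ∃ f', IsExpD σ f f' := by
  by_contra! hc
  simp [gevreyBourgainNorm, hc] at hf

end Norms

section ConjugationFactor

variable {d : ℕ} {σ : ℝ}

theorem l1norm_nonneg (ξ : EuclideanSpace ℝ (Fin d)) : 0 ≤ l1norm ξ :=
  Finset.sum_nonneg fun _ _ => abs_nonneg _

theorem abs_l1norm_sub_l1norm_sub_le (ξ η : EuclideanSpace ℝ (Fin d)) :
    |l1norm ξ - l1norm (ξ - η)| ≤ l1norm η :=
  calc |l1norm ξ - l1norm (ξ - η)| = |∑ i, (|ξ i| - |ξ i - η i|)| := by simp [l1norm]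
    _ ≤ ∑ i, |(|ξ i| - |ξ i - η i|)| := Finset.abs_sum_le_sum_abs _ _
    _ ≤ l1norm η := Finset.sum_le_sum fun i _ => by
        simpa using abs_abs_sub_abs_le (ξ i) (ξ i - η i)

theorem l1norm_le_mul_bracket (ξ : EuclideanSpace ℝ (Fin d)) : l1norm ξ ≤ d * bracket ‖ξ‖ :=
  calc l1norm ξ ≤ ∑ _i : Fin d, bracket ‖ξ‖ := Finset.sum_le_sum fun i _ =>
        (PiLp.norm_apply_le ξ i).trans ((le_abs_self _).trans (abs_le_bracket _))
    _ = d * bracket ‖ξ‖ := by simp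

@[fun_prop]
theorem continuous_l1norm : Continuous (l1norm (d := d)) := by
  unfold l1norm
  fun_prop

theorem abs_one_sub_exp_le {y L : ℝ} (h : |y| ≤ L) : |1 - Real.exp y| ≤ L * Real.exp L := by
  have hL : 0 ≤ L := (abs_nonneg y).trans h
  have hy : ‖Complex.exp y - 1‖ ≤ ‖(y : ℂ)‖ * Real.exp ‖(y : ℂ)‖ := by
    simpa using Complex.norm_exp_sub_sum_le_norm_mul_exp y 1
  rw [← Complex.ofReal_exp, ← Complex.ofReal_one, ← Complex.ofReal_sub, Complex.norm_real,
    Complex.norm_real, Real.norm_eq_abs, Real.norm_eq_abs, abs_sub_comm] at hy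
  refine hy.trans ?_
  gcongr

/-- The factor by which the passage from `v m` to `e^{σ‖D‖} (m e^{-σ‖D‖} v)` multiplies the
contribution of the frequencies `ξ - η` of `v` and `η` of `m` to the output frequency `ξ`. -/
def conjugationFactor (σ : ℝ) (ξ η : EuclideanSpace ℝ (Fin d)) : ℝ :=
  Real.exp (σ * (l1norm ξ - l1norm (ξ - η)))

@[fun_prop]
theorem continuous_conjugationFactor (σ : ℝ) : Continuous fun x : EuclideanSpace ℝ (Fin d) ×
    EuclideanSpace ℝ (Fin d) => conjugationFactor σ x.1 x.2 := by
  unfold conjugationFactor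
  fun_prop

theorem conjugationFactor_le (hσ : 0 ≤ σ) (ξ η : EuclideanSpace ℝ (Fin d)) :
    conjugationFactor σ ξ η ≤ Real.exp (σ * l1norm η) := by
  unfold conjugationFactor
  gcongr
  exact (le_abs_self _).trans (abs_l1norm_sub_l1norm_sub_le ξ η)

theorem abs_one_sub_conjugationFactor_le (hσ : 0 ≤ σ) (ξ η : EuclideanSpace ℝ (Fin d)) :
    |1 - conjugationFactor σ ξ η| ≤ σ * d * (bracket ‖η‖ * Real.exp (σ * l1norm η)) := by
  have hexp : |σ * (l1norm ξ - l1norm (ξ - η))| ≤ σ * l1norm η := by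
    rw [abs_mul, abs_of_nonneg hσ]
    gcongr
    exact abs_l1norm_sub_l1norm_sub_le ξ η
  calc |1 - conjugationFactor σ ξ η| ≤ σ * l1norm η * Real.exp (σ * l1norm η) :=
        abs_one_sub_exp_le hexp
    _ ≤ σ * (d * bracket ‖η‖) * Real.exp (σ * l1norm η) := by
        gcongr
        exact l1norm_le_mul_bracket η
    _ = σ * d * (bracket ‖η‖ * Real.exp (σ * l1norm η)) := by ring

variable {g k : Spacetime d → ℂ}

theorem exp_mul_integral_convolution_exp_neg_mul (ζ : Spacetime d) :
    (Real.exp (σ * l1norm ζ.snd) : ℂ) *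
        ∫ η, k (ζ - η) * ((Real.exp (-σ * l1norm η.snd) : ℂ) * g η) =
      ∫ η : Spacetime d, (conjugationFactor σ ζ.snd η.snd : ℂ) * (g (ζ - η) * k η) := by
  rw [← integral_const_mul, ← integral_sub_left_eq_self _ volume ζ]
  refine integral_congr_ae (.of_forall fun η => ?_)
  have hfactor : conjugationFactor σ ζ.snd η.snd =
      Real.exp (σ * l1norm ζ.snd) * Real.exp (-σ * l1norm (ζ - η).snd) := by
    rw [conjugationFactor, WithLp.sub_snd, ← Real.exp_add]
    ring_nf
  simp only [sub_sub_cancel, hfactor, Complex.ofReal_mul]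
  ring

theorem norm_conjugationFactor_mul_le (hσ : 0 ≤ σ) (ζ η : Spacetime d) :
    ‖(conjugationFactor σ ζ.snd η.snd : ℂ) * (g (ζ - η) * k η)‖ ≤
      ‖g (ζ - η) * ((Real.exp (σ * l1norm η.snd) : ℂ) * k η)‖ := by
  have hnonneg : 0 ≤ conjugationFactor σ ζ.snd η.snd := (Real.exp_pos _).le
  rw [mul_left_comm (g _)]
  simp only [norm_mul, Complex.norm_real, Real.norm_of_nonneg hnonneg, Real.norm_eq_abs,
    Real.abs_exp]
  gcongr
  exact conjugationFactor_le hσ _ _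

theorem enorm_integral_one_sub_conjugationFactor_mul_le (hσ : 0 ≤ σ)
    (ζ : Spacetime d) :
    ‖∫ η : Spacetime d, ((1 - conjugationFactor σ ζ.snd η.snd : ℝ) : ℂ) *
        (g (ζ - η) * k η)‖ₑ ≤
      ENNReal.ofReal (σ * d) * ∫⁻ η : Spacetime d, ‖g (ζ - η)‖ₑ *
        (bracketPow 1 ‖η.snd‖ * ‖(Real.exp (σ * l1norm η.snd) : ℂ) * k η‖ₑ) := by
  have hfactor : ∀ η : Spacetime d, ‖((1 - conjugationFactor σ ζ.snd η.snd : ℝ) : ℂ)‖ₑ ≤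
      ENNReal.ofReal (σ * d) *
        (bracketPow 1 ‖η.snd‖ * ‖(Real.exp (σ * l1norm η.snd) : ℂ)‖ₑ) := fun η => by
    rw [← ofReal_norm, ← ofReal_norm, Complex.norm_real, Complex.norm_real, Real.norm_eq_abs,
      Real.norm_eq_abs, Real.abs_exp, bracketPow, Real.rpow_one,
      ← ENNReal.ofReal_mul (bracket_pos _).le, ← ENNReal.ofReal_mul (by positivity)]
    exact ENNReal.ofReal_le_ofReal (abs_one_sub_conjugationFactor_le hσ _ _)
  refine (enorm_integral_le_lintegral_enorm _).trans ?_
  rw [← lintegral_const_mul' _ _ ENNReal.ofReal_ne_top]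
  refine lintegral_mono fun η => ?_
  simp only [enorm_mul]
  calc _ ≤ ENNReal.ofReal (σ * d) *
        (bracketPow 1 ‖η.snd‖ * ‖(Real.exp (σ * l1norm η.snd) : ℂ)‖ₑ) *
        (‖g (ζ - η)‖ₑ * ‖k η‖ₑ) := by
        gcongr
        exact hfactor η
    _ = _ := by ring

theorem memLp_of_one_le_mul {w : Spacetime d → ℝ} (hw : ∀ ζ, 1 ≤ w ζ)
    (hg : AEStronglyMeasurable g) (h : eLpNorm (fun ζ => (w ζ : ℂ) * g ζ) 2 volume < ∞) :
    MemLp g 2 := by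
  refine ⟨hg, lt_of_le_of_lt (eLpNorm_mono fun ζ => ?_) h⟩
  rw [norm_mul, Complex.norm_real, Real.norm_of_nonneg (zero_le_one.trans (hw ζ))]
  exact le_mul_of_one_le_left (norm_nonneg _) (hw ζ)

theorem memLp_of_memLp_exp_mul (hσ : 0 ≤ σ) (hk : AEStronglyMeasurable k)
    (h : MemLp (fun ζ : Spacetime d => (Real.exp (σ * l1norm ζ.snd) : ℂ) * k ζ) 2) :
    MemLp k 2 :=
  memLp_of_one_le_mul (fun _ => Real.one_le_exp (mul_nonneg hσ (l1norm_nonneg _))) hk h.2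

theorem memLp_exp_neg_mul (hσ : 0 ≤ σ) (hg : MemLp g 2) :
    MemLp (fun ζ : Spacetime d => (Real.exp (-σ * l1norm ζ.snd) : ℂ) * g ζ) 2 := by
  refine hg.mono (AEStronglyMeasurable.mul (Continuous.aestronglyMeasurable (by fun_prop)) hg.1)
    (.of_forall fun ζ => ?_)
  rw [norm_mul, Complex.norm_real, Real.norm_of_nonneg (Real.exp_pos _).le]
  exact mul_le_of_le_one_left (norm_nonneg _)
    (Real.exp_le_one_iff.2 (mul_nonpos_of_nonpos_of_nonneg (neg_nonpos.2 hσ) (l1norm_nonneg _)))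

variable (hσ : 0 ≤ σ) (hg : MemLp g 2) (hk : AEStronglyMeasurable k)
  (hk2 : MemLp (fun ζ : Spacetime d => (Real.exp (σ * l1norm ζ.snd) : ℂ) * k ζ) 2)
include hσ hg hk hk2

theorem memLp_top_integral_conjugationFactor_mul :
    MemLp (fun ζ : Spacetime d =>
      ∫ η : Spacetime d, (conjugationFactor σ ζ.snd η.snd : ℂ) * (g (ζ - η) * k η)) ∞ := by
  have hfactor : Continuous fun x : Spacetime d × Spacetime d =>
      (conjugationFactor σ x.1.snd x.2.snd : ℂ) := by fun_prop
  exact memLp_top_of_bound (hfactor.aestronglyMeasurable.mul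
    (aestronglyMeasurable_convolution_integrand hg.1 hk)).integral_prod_right' _
    (.of_forall fun ζ => norm_integral_le_of_norm_le_convolution hg hk2
      (norm_conjugationFactor_mul_le hσ ζ))

theorem integrable_conjugationFactor_mul (ζ : Spacetime d) :
    Integrable fun η : Spacetime d =>
      (conjugationFactor σ ζ.snd η.snd : ℂ) * (g (ζ - η) * k η) := by
  have hfactor : Continuous fun η : Spacetime d => (conjugationFactor σ ζ.snd η.snd : ℂ) := by
    fun_prop
  refine Integrable.mono ((memLp_comp_sub_left hg ζ).integrable_mul hk2)
    (hfactor.aestronglyMeasurable.mul ((memLp_comp_sub_left hg ζ).1.mul hk))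
    (.of_forall (norm_conjugationFactor_mul_le hσ ζ))

theorem exists_isCommutator {v m : 𝓢'(Spacetime d, ℂ)} (hv : HasFourier v g)
    (hm : HasFourier m k) :
    ∃ F : 𝓢'(Spacetime d, ℂ), IsCommutator σ v m F ∧ HasFourier F fun ζ => (fourierConst d : ℂ) *
      ∫ η : Spacetime d, ((1 - conjugationFactor σ ζ.snd η.snd : ℝ) : ℂ) *
        (g (ζ - η) * k η) := by
  have hk' := memLp_of_memLp_exp_mul hσ hk hk2
  have hgk (ζ : Spacetime d) : Integrable fun η => g (ζ - η) * k η :=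
    (memLp_comp_sub_left hg ζ).integrable_mul hk'
  have hw' := memLp_exp_neg_mul hσ hg
  obtain ⟨p, hp, hpF⟩ := exists_isProduct hv hg hm hk'
  obtain ⟨w, hw⟩ := exists_hasFourier one_le_two hw'
  obtain ⟨q, hq, hqF⟩ := exists_isProduct hm hk' hw hw'
  obtain ⟨r, hr⟩ := exists_hasFourier le_top
    ((memLp_top_integral_conjugationFactor_mul hσ hg hk hk2).const_mul (fourierConst d : ℂ))
  have hqr : IsExpD σ q r := ⟨_, hqF, by
    simpa only [mul_left_comm _ (fourierConst d : ℂ),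
      exp_mul_integral_convolution_exp_neg_mul] using hr⟩
  refine ⟨p - r, ⟨p, w, q, r, hp, ⟨g, hv, hw⟩, hq, hqr, rfl⟩, (hpF.sub hr).congr ?_⟩
  refine .of_forall fun ζ => ?_
  change _ - _ = _
  rw [← mul_sub, ← integral_sub (hgk ζ) (integrable_conjugationFactor_mul hσ hg hk hk2 ζ)]
  simp [sub_mul]

end ConjugationFactor

section Norms

variable {d : ℕ} {h : EuclideanSpace ℝ (Fin d) → ℝ} {s b : ℝ} {f : 𝓢'(Spacetime d, ℂ)}
  {g : Spacetime d → ℂ}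

theorem lipschitzWith_hWave (pm : PM) : LipschitzWith 1 (hWave (d := d) pm) := by
  cases pm
  · exact lipschitzWith_one_norm.neg
  · exact lipschitzWith_one_norm

theorem hWave_zero (pm : PM) : hWave pm (0 : EuclideanSpace ℝ (Fin d)) = 0 := by
  cases pm <;> simp [hWave]

theorem sq_bourgainNorm (hg : HasFourier f g) :
    bourgainNorm h s b f ^ 2 = ∫⁻ ζ : Spacetime d,
      (bracketPow s ‖ζ.snd‖ * bracketPow b (modulation h ζ) * ‖g ζ‖ₑ) ^ 2 := by
  have hweight : ∀ p r : ℝ, ‖((bracket r ^ p : ℝ) : ℂ)‖ₑ = bracketPow p r := fun p r => by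
    rw [← ofReal_norm, Complex.norm_of_nonneg (Real.rpow_nonneg (bracket_pos r).le p), bracketPow]
  rw [bourgainNorm_eq hg]
  simpa [hweight, modulation] using eLpNorm_nnreal_pow_eq_lintegral (μ := volume) (p := 2)
    (f := fun ζ : Spacetime d =>
      ((bracket ‖ζ.snd‖ ^ s * bracket (ζ.fst - h ζ.snd) ^ b : ℝ) : ℂ) * g ζ) two_ne_zero

theorem sq_bourgainNorm_conj (hg : HasFourier f g) :
    bourgainNorm h s b (conjDistribution f) ^ 2 = ∫⁻ ζ : Spacetime d,
      (bracketPow s ‖ζ.snd‖ * bracketPow b (modulation (fun ξ => -h (-ξ)) ζ) * ‖g ζ‖ₑ) ^ 2 := by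
  rw [sq_bourgainNorm hg.conj, ← lintegral_neg_eq_self]
  refine lintegral_congr fun ζ => ?_
  have hmod : modulation h (-ζ) = -modulation (fun ξ => -h (-ξ)) ζ := by
    simp [modulation]
    ring
  rw [hmod, bracketPow_neg_arg, neg_neg, WithLp.neg_snd, norm_neg, RCLike.enorm_conj]

theorem memLp_of_bourgainNorm_lt_top (hs : 0 ≤ s) (hb : 0 ≤ b) (hg : HasFourier f g)
    (hf : bourgainNorm h s b f < ∞) : MemLp g 2 := by
  rw [bourgainNorm_eq hg] at hf
  exact memLp_of_one_le_mul (fun ζ => one_le_mul_of_one_le_of_one_le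
    (Real.one_le_rpow (one_le_bracket _) hs) (Real.one_le_rpow (one_le_bracket _) hb))
    hg.aestronglyMeasurable hf

end Norms

section CommutatorEstimate

variable {d : ℕ} {h : EuclideanSpace ℝ (Fin d) → ℝ} {σ a b : ℝ}
  {v m F : 𝓢'(Spacetime d, ℂ)} {g k : Spacetime d → ℂ}

theorem sq_bourgainNorm_conj_le (hσ : 0 ≤ σ) (hF : HasFourier F fun ζ => (fourierConst d : ℂ) *
      ∫ η : Spacetime d, ((1 - conjugationFactor σ ζ.snd η.snd : ℝ) : ℂ) * (g (ζ - η) * k η)) :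
    bourgainNorm hSchr 0 (-a) (conjDistribution F) ^ 2 ≤
      ENNReal.ofReal (fourierConst d * (σ * d)) ^ 2 *
        ∫⁻ ζ, (bracketPow (-a) (modulation (‖·‖ ^ 2) ζ) * ∫⁻ η : Spacetime d, ‖g (ζ - η)‖ₑ *
          (bracketPow 1 ‖η.snd‖ * ‖(Real.exp (σ * l1norm η.snd) : ℂ) * k η‖ₑ)) ^ 2 := by
  have hphase : (fun ξ : EuclideanSpace ℝ (Fin d) => -hSchr (-ξ)) = (‖·‖ ^ 2) := by
    ext ξ
    simp [hSchr]
  rw [sq_bourgainNorm_conj hF, hphase, ← lintegral_const_mul' _ _ (by simp)]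
  refine lintegral_mono fun ζ => ?_
  rw [← mul_pow, bracketPow_zero, one_mul, enorm_mul, ← ofReal_norm (fourierConst d : ℂ),
    Complex.norm_of_nonneg (fourierConst_pos d).le, ENNReal.ofReal_mul (fourierConst_pos d).le]
  gcongr ?_ ^ 2
  have hint := enorm_integral_one_sub_conjugationFactor_mul_le hσ (g := g) (k := k) ζ
  exact (mul_le_mul_right (mul_le_mul_right hint _) _).trans_eq (by ring)

theorem lintegral_sq_weighted_convolution_le {m' : 𝓢'(Spacetime d, ℂ)} (hg : Measurable g)
    (hk : Measurable k) (hvg : HasFourier v g) (hmk : HasFourier m k) (hm' : IsExpD σ m m')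
    (hd : d ≠ 0) (hb : 0 ≤ b) (ha : ((d - 2 : ℕ) : ℝ) ≤ 4 * a) (hab : a ≤ b)
    (hh : LipschitzWith 1 h) (h0 : h 0 = 0) :
    ∫⁻ ζ, (bracketPow (-a) (modulation (‖·‖ ^ 2) ζ) * ∫⁻ η : Spacetime d, ‖g (ζ - η)‖ₑ *
        (bracketPow 1 ‖η.snd‖ * ‖(Real.exp (σ * l1norm η.snd) : ℂ) * k η‖ₑ)) ^ 2 ≤
      9 * resonanceConst d (2 * b) * bourgainNorm hSchr 0 b v ^ 2 *
        gevreyBourgainNorm h σ 1 b m ^ 2 := by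
  have hexp : Measurable fun η : Spacetime d => (Real.exp (σ * l1norm η.snd) : ℂ) :=
    Continuous.measurable (by fun_prop)
  have hM : Measurable fun η : Spacetime d =>
      bracketPow 1 ‖η.snd‖ * ‖(Real.exp (σ * l1norm η.snd) : ℂ) * k η‖ₑ :=
    Measurable.mul (by fun_prop) (hexp.mul hk).enorm
  refine (lintegral_sq_schrodinger_convolution_le hd hb ha hab hh h0 hg.enorm hM).trans_eq ?_
  rw [gevreyBourgainNorm_eq hm', sq_bourgainNorm hvg, sq_bourgainNorm (hm'.hasFourier hmk)]
  simp only [bracketPow_zero, one_mul, mul_left_comm (bracketPow b _), mul_assoc]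

theorem exists_isCommutator_sq_bourgainNorm_conj_le (hd : d ≠ 0) (hb : 0 ≤ b)
    (ha : ((d - 2 : ℕ) : ℝ) ≤ 4 * a) (hab : a ≤ b) (hh : LipschitzWith 1 h) (h0 : h 0 = 0)
    (hσ : 0 ≤ σ) (hv : bourgainNorm hSchr 0 b v < ∞) (hm : gevreyBourgainNorm h σ 1 b m < ∞) :
    ∃ F, IsCommutator σ v m F ∧ bourgainNorm hSchr 0 (-a) (conjDistribution F) ^ 2 ≤
      ENNReal.ofReal (fourierConst d * (σ * d)) ^ 2 * (9 * resonanceConst d (2 * b) *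
        bourgainNorm hSchr 0 b v ^ 2 * gevreyBourgainNorm h σ 1 b m ^ 2) := by
  obtain ⟨_, hv'⟩ := exists_hasFourier_of_bourgainNorm_lt_top hv
  obtain ⟨g, hg, hvg⟩ := hv'.exists_stronglyMeasurable
  obtain ⟨m', hm'⟩ := exists_isExpD_of_gevreyBourgainNorm_lt_top hm
  obtain ⟨k, hk, hmk⟩ := (hm'.choose_spec.1).exists_stronglyMeasurable
  have hk2 := memLp_of_bourgainNorm_lt_top zero_le_one hb (hm'.hasFourier hmk)
    (gevreyBourgainNorm_eq hm' ▸ hm)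
  obtain ⟨F, hF, hFg⟩ := exists_isCommutator hσ (memLp_of_bourgainNorm_lt_top le_rfl hb hvg hv)
    hk.aestronglyMeasurable hk2 hvg hmk
  refine ⟨F, hF, (sq_bourgainNorm_conj_le hσ hFg).trans ?_⟩
  gcongr
  exact lintegral_sq_weighted_convolution_le hg.measurable hk.measurable hvg hmk hm' hd hb ha hab
    hh h0

end CommutatorEstimate

theorem exists_pos_le_ofReal_sq {x : ℝ≥0∞} (hx : x ≠ ∞) :
    ∃ R : ℝ, 0 < R ∧ x ≤ ENNReal.ofReal R ^ 2 := by
  refine ⟨x.toReal + 1, by positivity, ?_⟩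
  rw [← ENNReal.ofReal_pow (by positivity), ENNReal.le_ofReal_iff_toReal_le hx (by positivity)]
  nlinarith [x.toReal_nonneg]

end GevreyBourgain

end

theorem lemma4p3_general {d : ℕ} (hd : d ≠ 0) {b b' : ℝ} (hb : 1 / 2 < b) (hbb' : 1 ≤ b + b')
    (hb' : b' ≤ min ((6 - (d : ℝ)) / 4) 1) :
    ∃ C : ℝ, 0 < C ∧ ∀ h : EuclideanSpace ℝ (Fin d) → ℝ, LipschitzWith 1 h → h 0 = 0 →
      ∀ σ : ℝ, 0 ≤ σ → ∀ v m : 𝓢'(Spacetime d, ℂ),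
        bourgainNorm hSchr 0 b v < ∞ → gevreyBourgainNorm h σ 1 b m < ∞ →
          (∃! F : 𝓢'(Spacetime d, ℂ), IsCommutator σ v m F) ∧
          ∀ F : 𝓢'(Spacetime d, ℂ), IsCommutator σ v m F →
            bourgainNorm hSchr 0 (b' - 1) (conjDistribution F) ≤
              ENNReal.ofReal (C * σ) * bourgainNorm hSchr 0 b v *
                gevreyBourgainNorm h σ 1 b m := by
  obtain ⟨hbd, hb1⟩ := le_min_iff.1 hb'
  have ha : ((d - 2 : ℕ) : ℝ) ≤ 4 * (1 - b') := by
    rcases le_total d 2 with h | h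
    · simp [h, hb1]
    · push_cast [h]
      linarith
  have hres := resonanceConst_lt_top d (show 1 < 2 * b by linarith)
  obtain ⟨R, hR, hresR⟩ := exists_pos_le_ofReal_sq (x := 9 * resonanceConst d (2 * b))
    (by finiteness)
  have hd0 : (0 : ℝ) < d := by exact_mod_cast hd.bot_lt
  have hc := fourierConst_pos d
  refine ⟨fourierConst d * d * R, mul_pos (mul_pos hc hd0) hR, fun h hh h0 σ hσ v m hv hm => ?_⟩
  obtain ⟨F, hF, hest⟩ := exists_isCommutator_sq_bourgainNorm_conj_le hd (by linarith) ha
    (by linarith) hh h0 hσ hv hm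
  refine ⟨⟨F, hF, fun F' hF' => hF'.unique hF⟩, fun F' hF' => ?_⟩
  obtain rfl := hF'.unique hF
  rw [← neg_sub, ← ENNReal.pow_le_pow_left_iff two_ne_zero]
  calc _ ≤ ENNReal.ofReal (fourierConst d * (σ * d)) ^ 2 * (ENNReal.ofReal R ^ 2 *
        bourgainNorm hSchr 0 b v ^ 2 * gevreyBourgainNorm h σ 1 b m ^ 2) := by
        grw [hest, hresR]
    _ = (ENNReal.ofReal (fourierConst d * d * R * σ) * bourgainNorm hSchr 0 b v *
          gevreyBourgainNorm h σ 1 b m) ^ 2 := by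
        have hconst : ENNReal.ofReal (fourierConst d * d * R * σ) =
            ENNReal.ofReal (fourierConst d * (σ * d)) * ENNReal.ofReal R := by
          rw [← ENNReal.ofReal_mul (by positivity)]
          ring_nf
        rw [hconst]
        ring

theorem lemma4p3 (d : ℕ) (hd : d = 1 ∨ d = 2 ∨ d = 3) (b b' : ℝ) (hb : 1 / 2 < b) (hbb' : b ≤ b')
    (hb' : b' < min ((6 - (d : ℝ)) / 4) 1) :
    ∃ C : ℝ, 0 < C ∧ ∀ σ : ℝ, 0 ≤ σ → ∀ (pm : PM) (v m : 𝓢'(Spacetime d, ℂ)),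
      bourgainNorm hSchr 0 b v < ∞ → gevreyBourgainNorm (hWave pm) σ 1 b m < ∞ →
        (∃! F : 𝓢'(Spacetime d, ℂ), IsCommutator σ v m F) ∧
        ∀ F : 𝓢'(Spacetime d, ℂ), IsCommutator σ v m F →
          bourgainNorm hSchr 0 (b' - 1) (conjDistribution F) ≤
            ENNReal.ofReal (C * σ) * bourgainNorm hSchr 0 b v *
              gevreyBourgainNorm (hWave pm) σ 1 b m := by
  obtain ⟨C, hC, hest⟩ := lemma4p3_general (by omega) hb (by linarith) hb'.le
  exact ⟨C, hC, fun σ hσ pm v m => hest _ (lipschitzWith_hWave pm) (hWave_zero pm) σ hσ v m⟩
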